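/- **Model.** Let $(u_i,\bm m_i,\bm x_i,y_i)$, $i\ge 1$, be i.i.d. with $u_i\in\mathbb R$, mediators $\bm m_i\in\mathbb R^p$, exposures $\bm x_i\in\mathbb R^q$, response $y_i\in\mathbb R$. Conditionally on $(u_i,\bm m_i,\bm x_i)$, $y_i$ has density $c(y,\phi)\exp\{(y\theta_i-b(\theta_i))/\phi\}$, $\phi>0$, from an exponential family whose parameter space $\Theta$ is an open interval, with canonical parameter $\theta_i=\bm\alpha_0(u_i)^T\bm m_i+\bm\alpha_1(u_i)^T\bm x_i$. Moreover $\bm m_i=\bm\Gamma(u_i)^T\bm x_i+\bm\epsilon_i$, where $\bm\epsilon_i$ has mean $\bm 0$ and covariance matrix $\bm\Sigma_\epsilon$ and is independent of $(\bm x_i,u_i)$. **Conditions.** - (C1) $u_i$ has a Lebesgue density on a compact interval $\mathcal U$ that is bounded away from $0$ and $\infty$ on $\mathcal U$. - (C2) The components of $\bm\alpha_0,\bm\alpha_1$ have $r_1$-th derivatives that are Lipschitz of order $\eta_1$ on $\mathcal U$, and the components of $\bm\Gamma$ have $r_2$-th derivatives that are Lipschitz of order $\eta_2$ on $\mathcal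 U$, where $r_k\ge 0$ are integers, $\eta_k\in(0,1]$ and $r_k+\eta_k>1/2$. - (C3) $\mathrm E(\bm x_i\bm x_i^T)$ and $\mathrm E(\bm m_i\bm m_i^T)$ are finite with eigenvalues bounded away from $0$ and $\infty$. - (C4) The eigenvalues of $\bm\Sigma_\epsilon$ are bounded away from $0$ and $\infty$. - (C5) $\bm\Gamma,\bm\alpha_0,\bm\alpha_1$ are twice continuously differentiable on $\mathcal U$. - (C6) Let $\bm b_0,\bm b_1,\bm B$ be vectors of $K_0,K_1,K_m$ B-spline basis functions on $\mathcal U$. Their degrees, knots and numbers do not depend on the sample size $n$ (so that $\limsup_n \max_\omega K_\omega/\min_\omega K_\omega<\infty$). The spline approximation is exact: on $\mathcal U$, $\bm\alpha_0(u)=\{\bm I_p\otimes\bm b_0(u)^T\}\bm\alpha_0^*$, $\bm\alpha_1(u)=\{\bm I_q\otimes\bm b_1(u)^T\}\bm\alpha_1^*$ and $\bm\Gamma(u)=\{\bm I_q\otimes\bm B(u)^T\}\bm C$ for some $\bm\alpha_0^*\in\mathbb R^{pK_0}$, $\bm\alpha_1^*\in\mathbb R^{qK_1}$, $\bm C\in\mathbb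 R^{qK_m\times p}$. Put $\bm m_i^*=\bm m_i\otimes\bm b_0(u_i)$, $\bm x_i^*=\bm x_i\otimes\bm b_1(u_i)$, $\bm z_i^*=(\bm m_i^{*T},\bm x_i^{*T})^T$. For $\bm v,\bm w\in\{\bm m,\bm x\}$ let $\bm\Sigma_{v^*w^*}=\mathrm E\{\bm v_i^*\bm w_i^{*T}\,b''(\bm\alpha_0^{*T}\bm m_i^*+\bm\alpha_1^{*T}\bm x_i^*)\}$, and let $$\bm\Sigma_{x^*x^*\mid m^*}=\bm\Sigma_{x^*x^*}-\bm\Sigma_{x^*m^*}\bm\Sigma_{m^*m^*}^{-1}\bm\Sigma_{m^*x^*}.$$ Assume that $\bm\Sigma_{m^*m^*}$ and $\bm\Sigma_{x^*x^*\mid m^*}$ are invertible. Assume also that the likelihood is regular at the true coefficient vector $\bm\alpha^*=(\bm\alpha_0^{*T},\bm\alpha_1^{*T})^T$, in the following sense: for all $\bm a$ in a neighbourhood of $\bm\alpha^*$, $\bm a^T\bm z_i^*\in\Theta$ almost surely and the Fisher information $\bm I_1(\bm a)=\mathrm E\{\bm z_i^*\bm z_i^{*T}b''(\bm a^T\bm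 z_i^*)\}$ is finite, and $\bm I_1$ is continuous at $\bm\alpha^*$. Let $(\hat{\bm\alpha}_0^*,\hat{\bm\alpha}_1^*)$ be a maximum-likelihood estimator of the spline coefficients from the first $n$ observations, that is, a random vector that almost surely maximizes the likelihood whenever a maximizer exists (over all coefficient vectors $\bm a$ with $\bm a^T\bm z_i^*\in\Theta$ for $i\le n$). Let $\hat{\bm\alpha}_1(u)=\{\bm I_q\otimes\bm b_1(u)^T\}\hat{\bm\alpha}_1^*$. **Theorem 1.** For every $u\in\mathcal U$, the matrix $$\mathrm{Var}\{\hat{\bm\alpha}_1(u)\}:=\tfrac{\phi}{n}\{\bm I_q\otimes\bm b_1(u)^T\}\bm\Sigma_{x^*x^*\mid m^*}^{-1}\{\bm I_q\otimes\bm b_1(u)\}$$ is positive definite, and $$[\mathrm{Var}\{\hat{\bm\alpha}_1(u)\}]^{-1/2}\{\hat{\bm\alpha}_1(u)-\bm\alpha_1(u)\}\overset{D}{\longrightarrow}N(\bm 0,\bm I_q)\qquad(n\to\infty).$$ -/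

import Mathlib

open MeasureTheory ProbabilityTheory Filter Topology

open scoped Kronecker

noncomputable section

namespace GVCMM

/-! ## B-splines -/

open Classical in
/-- The Cox-de Boor recursion: `bspline hi t d i` is the `i`-th B-spline of degree `d` for the
nondecreasing knot sequence `t`, with the convention `0 / 0 = 0`. Degree-zero B-splines are
indicators of half-open intervals, closed on the left at points below `hi` and closed on the right
from `hi` on, so that the basis is left-continuous at the right end point `hi` of the domain. -/
def bspline (hi : ℝ) (t : ℕ → ℝ) : ℕ → ℕ → ℝ → ℝ
  | 0, i, x =>
      if (x < hi ∧ t i ≤ x ∧ x < t (i + 1)) ∨ (hi ≤ x ∧ t i < x ∧ x ≤ t (i + 1)) then 1 else 0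
  | d + 1, i, x =>
      (x - t i) / (t (i + d + 1) - t i) * bspline hi t d i x
        + (t (i + d + 2) - x) / (t (i + d + 2) - t (i + 1)) * bspline hi t d (i + 1) x

/-- A degree and a knot sequence for which the `K` B-splines with indices `0, …, K - 1` form a basis
of a space of spline functions on `[lo, hi]`. Only the knots with indices `0, …, K + degree`
matter; clamped knot sequences (end knots repeated `degree + 1` times) are included. -/
structure BSplineBasis (lo hi : ℝ) (K : ℕ) where
  degree : ℕ
  knot : ℕ → ℝ
  mono : Monotone knot
  knot_left : knot degree = lo
  knot_right : knot K = hi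
  lo_lt : ∀ i, degree < i → lo < knot i
  lt_hi : ∀ i, i < K → knot i < hi
  multiplicity : ∀ i, i < K → knot i < knot (i + degree + 1)

/-- The vector of basis functions at `u`. -/
def BSplineBasis.eval {lo hi : ℝ} {K : ℕ} (β : BSplineBasis lo hi K) (u : ℝ) : Fin K → ℝ :=
  fun k => bspline hi β.knot β.degree k u

/-! ## Smoothness class -/

/-- Functions on `S` whose `r`-th derivative exists and is Lipschitz of order `η` with
constant `L`. -/
def HolderClass (S : Set ℝ) (r : ℕ) (η L : ℝ) (f : ℝ → ℝ) : Prop :=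
  ContDiffOn ℝ r f S ∧ ∀ s ∈ S, ∀ t ∈ S,
    |iteratedDerivWithin r f S s - iteratedDerivWithin r f S t| ≤ L * |s - t| ^ η

/-! ## Exponential families -/

/-- An exponential family with densities `c(y, φ) exp ((y θ - b θ) / φ)`, `θ ∈ Θ`, with respect to
the dominating measure `base`, at a fixed dispersion `φ`; `c` stands for `c(·, φ)`. The parameter
space `Θ` is an open interval. -/
structure ExpFamily where
  base : Measure ℝ
  sigmaFinite : SigmaFinite base
  φ : ℝ
  φ_pos : 0 < φ
  c : ℝ → ℝ
  c_measurable : Measurable c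
  c_nonneg : ∀ y, 0 ≤ c y
  b : ℝ → ℝ
  Θ : Set ℝ
  Θ_open : IsOpen Θ
  Θ_convex : Convex ℝ Θ
  normalized : ∀ θ ∈ Θ,
    ∫⁻ y, ENNReal.ofReal (c y * Real.exp ((y * θ - b θ) / φ)) ∂base = 1

/-- The density `c(y, φ) exp ((y θ - b θ) / φ)`. -/
def ExpFamily.density (F : ExpFamily) (θ y : ℝ) : ℝ :=
  F.c y * Real.exp ((y * θ - F.b θ) / F.φ)

/-- The member of the family with natural parameter `θ`. -/
def ExpFamily.law (F : ExpFamily) (θ : ℝ) : Measure ℝ :=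
  F.base.withDensity fun y => ENNReal.ofReal (F.density θ y)

/-! ## Spline regression and maximum likelihood -/

/-- `(v₁ βᵀ, v₂ βᵀ, …)ᵀ`. -/
def expand {I : Type*} {K : ℕ} (v : I → ℝ) (β : Fin K → ℝ) : I × Fin K → ℝ :=
  fun s => v s.1 * β s.2

/-- Pairs `(α₀*, α₁*)` of spline coefficient vectors. -/
abbrev Coef (p q K₀ K₁ : ℕ) : Type := (Fin p × Fin K₀ → ℝ) × (Fin q × Fin K₁ → ℝ)

/-- `α₀*ᵀ m* + α₁*ᵀ x*`. -/
def linPred {p q K₀ K₁ : ℕ} (a : Coef p q K₀ K₁) (ms : Fin p × Fin K₀ → ℝ)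
    (xs : Fin q × Fin K₁ → ℝ) : ℝ :=
  a.1 ⬝ᵥ ms + a.2 ⬝ᵥ xs

/-- The log-likelihood of the first `n` observations. -/
def logLik {p q K₀ K₁ : ℕ} (F : ExpFamily) (n : ℕ) (ms : ℕ → Fin p × Fin K₀ → ℝ)
    (xs : ℕ → Fin q × Fin K₁ → ℝ) (y : ℕ → ℝ) (a : Coef p q K₀ K₁) : ℝ :=
  ∑ i ∈ Finset.range n, Real.log (F.density (linPred a (ms i) (xs i)) (y i))

/-- The coefficients for which the first `n` natural parameters lie in the parameter space. -/
def admissible {p q K₀ K₁ : ℕ} (F : ExpFamily) (n : ℕ) (ms : ℕ → Fin p × Fin K₀ → ℝ)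
    (xs : ℕ → Fin q × Fin K₁ → ℝ) : Set (Coef p q K₀ K₁) :=
  {a | ∀ i < n, linPred a (ms i) (xs i) ∈ F.Θ}

/-- `a` is a maximum-likelihood estimate from the first `n` observations. -/
def IsMLE {p q K₀ K₁ : ℕ} (F : ExpFamily) (n : ℕ) (ms : ℕ → Fin p × Fin K₀ → ℝ)
    (xs : ℕ → Fin q × Fin K₁ → ℝ) (y : ℕ → ℝ) (a : Coef p q K₀ K₁) : Prop :=
  a ∈ admissible F n ms xs ∧ IsMaxOn (logLik F n ms xs y) (admissible F n ms xs) a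

/-! ## Moment matrices -/

/-- All eigenvalues of `A` lie between two positive constants. -/
def EigenvaluesBounded {I : Type*} [Fintype I] [DecidableEq I] (A : Matrix I I ℝ) : Prop :=
  ∃ N₁ N₂ : ℝ, 0 < N₁ ∧ 0 < N₂ ∧
    ∀ μ : ℝ, Module.End.HasEigenvalue (Matrix.toLin' A) μ → N₁ ≤ μ ∧ μ ≤ N₂

variable {Ω : Type*} [MeasurableSpace Ω]

/-- `E (w v v'ᵀ)`. -/
def weightedMoment {I J : Type*} (P : Measure Ω) (w : Ω → ℝ) (v : Ω → I → ℝ) (v' : Ω → J → ℝ) :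
    Matrix I J ℝ :=
  Matrix.of fun s t => ∫ ω, v ω s * v' ω t * w ω ∂P

/-- `E (v vᵀ)`. -/
def secondMoment {I : Type*} (P : Measure Ω) (v : Ω → I → ℝ) : Matrix I I ℝ :=
  Matrix.of fun s t => ∫ ω, v ω s * v ω t ∂P

/-- The covariance matrix of `v`. -/
def covMatrix {I : Type*} (P : Measure Ω) (v : Ω → I → ℝ) : Matrix I I ℝ :=
  Matrix.of fun s t => cov[fun ω => v ω s, fun ω => v ω t; P]

/-- The weight `b''(α₀*ᵀ m* + α₁*ᵀ x*)` of one observation. -/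
def weight {p q K₀ K₁ : ℕ} (F : ExpFamily) (ms : Ω → Fin p × Fin K₀ → ℝ)
    (xs : Ω → Fin q × Fin K₁ → ℝ) (a : Coef p q K₀ K₁) : Ω → ℝ :=
  fun ω => iteratedDeriv 2 F.b (linPred a (ms ω) (xs ω))

/-- The weighted Fisher information `I₁(a) = E {z* z*ᵀ b''(aᵀ z*)}` of one observation, where
`z* = (m*ᵀ, x*ᵀ)ᵀ`. -/
def fisherInfo {p q K₀ K₁ : ℕ} (P : Measure Ω) (F : ExpFamily) (ms : Ω → Fin p × Fin K₀ → ℝ)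
    (xs : Ω → Fin q × Fin K₁ → ℝ) (a : Coef p q K₀ K₁) :
    Matrix ((Fin p × Fin K₀) ⊕ (Fin q × Fin K₁)) ((Fin p × Fin K₀) ⊕ (Fin q × Fin K₁)) ℝ :=
  weightedMoment P (weight F ms xs a) (fun ω => Sum.elim (ms ω) (xs ω))
    (fun ω => Sum.elim (ms ω) (xs ω))

/-- Regularity of the likelihood model at the coefficients `a₀`: for all `a` near `a₀` the natural
parameter almost surely lies in the parameter space and `I₁(a)` is finite, and `I₁` is continuous
at `a₀`. -/
def RegularAt {p q K₀ K₁ : ℕ} (P : Measure Ω) (F : ExpFamily) (ms : Ω → Fin p × Fin K₀ → ℝ)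
    (xs : Ω → Fin q × Fin K₁ → ℝ) (a₀ : Coef p q K₀ K₁) : Prop :=
  (∀ᶠ a in 𝓝 a₀, (∀ᵐ ω ∂P, linPred a (ms ω) (xs ω) ∈ F.Θ) ∧
    ∀ s t, Integrable (fun ω => Sum.elim (ms ω) (xs ω) s * Sum.elim (ms ω) (xs ω) t
      * weight F ms xs a ω) P) ∧
  ContinuousAt (fisherInfo P F ms xs) a₀

/-- The Schur complement `Σ_xx|m = Σ_xx - Σ_xm Σ_mm⁻¹ Σ_mx` of the weighted moment matrices. -/
def schurX {I J : Type*} [Fintype I] [DecidableEq I] (P : Measure Ω) (w : Ω → ℝ) (ms : Ω → I → ℝ)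
    (xs : Ω → J → ℝ) : Matrix J J ℝ :=
  weightedMoment P w xs xs
    - weightedMoment P w xs ms * (weightedMoment P w ms ms)⁻¹ * weightedMoment P w ms xs

/-- `I_q ⊗ βᵀ`, a matrix with `q` rows. -/
def kronRow (q : ℕ) {K : ℕ} (β : Fin K → ℝ) : Matrix (Fin q) (Fin q × Fin K) ℝ :=
  ((1 : Matrix (Fin q) (Fin q) ℝ) ⊗ₖ Matrix.replicateRow Unit β).submatrix (fun l => (l, ())) id

/-- The symmetric inverse square root `A ^ (-1/2)` of a positive definite matrix. -/
def invSqrt {I : Type*} [Fintype I] [DecidableEq I] (A : Matrix I I ℝ) : Matrix I I ℝ :=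
  cfc (fun x : ℝ => (√x)⁻¹) A

end GVCMM

end

open GVCMM

/-! Since the spline representation is exact, the model is a canonical-link generalized linear model
with a fixed number of coefficients, and there is no approximation bias. The proof studies its
maximum-likelihood estimator through convexity rather than through consistency or third derivatives.

In the local parameter s = √n (a' - a), the log-likelihood increment is, up to the factor -1/φ, a
convex function `localLoss` minus the linear form sᵀU, with U the normalized score sum
(`designLogLik_local`). If `localLoss` converges pointwise in probability to sᵀJs/2, where J is the
Fisher information, convexity upgrades this to uniform closeness on balls. Hence, with probability
tending to one, a maximizer exists and every maximizer lies near J⁻¹U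
(`tendstoInMeasure_argmin_sub`, `RegularGLM.tendstoInMeasure_mle`). Existence comes out of the
argument, so an estimator that is specified only when a maximizer exists is enough.

Pointwise convergence needs no integrable envelope for b''. By Tonelli, the mean Taylor remainder is
an average of quadratic forms of the information along a short segment; continuity of the
information bounds it asymptotically by its limit, and Scheffé's lemma gives convergence in mean
(`tendsto_integral_scaledRemainder`). The law of large numbers then handles the limiting summands.

The conditional law of the response makes the score centred with covariance φJ, so the central limit
theorem and characteristic functions give the Gaussian limit of U. The exposure block of J⁻¹ is the
inverse Schur complement (`fromCols_zero_mul_inv_fromBlocks_mul`), which identifies the variance in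
the statement. The partition of unity of the B-splines makes the basis vector nonzero at every
point, whence positive definiteness. -/

namespace GVCMM

/-! ## Partition of unity for B-splines -/

section Spline

variable {hi : ℝ} {t : ℕ → ℝ}

lemma measurable_bspline (hi : ℝ) (t : ℕ → ℝ) (d i : ℕ) : Measurable (bspline hi t d i) := by
  induction d generalizing i with
  | zero =>
    have : bspline hi t 0 i = fun x => if (x < hi ∧ t i ≤ x ∧ x < t (i + 1)) ∨
        (hi ≤ x ∧ t i < x ∧ x ≤ t (i + 1)) then 1 else 0 := by
      ext x; simp only [bspline]
    rw [this]
    refine Measurable.ite ?_ measurable_const measurable_const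
    measurability
  | succ d ih =>
    have : bspline hi t (d + 1) i = fun x =>
        (x - t i) / (t (i + d + 1) - t i) * bspline hi t d i x
        + (t (i + d + 2) - x) / (t (i + d + 2) - t (i + 1)) * bspline hi t d (i + 1) x := by
      ext x; simp only [bspline]
    rw [this]
    have h1 := ih i
    have h2 := ih (i + 1)
    fun_prop

/-- The two alternatives reflect the end-point convention: below `hi` the degree-zero pieces are
right-open, so reaching the last knot suffices; from `hi` on they are right-closed and it has to be
passed strictly. -/
lemma bspline_eq_zero_of_le (ht : Monotone t) {d i : ℕ} {x : ℝ}
    (h : x < hi ∧ t (i + d + 1) ≤ x ∨ t (i + d + 1) < x) : bspline hi t d i x = 0 := by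
  induction d generalizing i with
  | zero =>
    simp only [bspline]
    rw [if_neg]
    simp only [add_zero] at h
    rintro (⟨h1, h2, h3⟩ | ⟨h1, h2, h3⟩) <;> rcases h with ⟨h4, h5⟩ | h4 <;> linarith
  | succ d ih =>
    simp only [bspline]
    have e : i + 1 + d + 1 = i + (d + 1) + 1 := by ring
    have h0 : t (i + d + 1) ≤ t (i + (d + 1) + 1) := ht (by omega)
    rw [ih, ih]
    · simp
    · rwa [e]
    · rcases h with h | h
      · exact Or.inl ⟨h.1, h0.trans h.2⟩
      · exact Or.inr (h0.trans_lt h)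

lemma bspline_eq_zero_of_hi_le (ht : Monotone t) {d i : ℕ} {x : ℝ} (hx : x ≤ hi) (h : hi ≤ t i) :
    bspline hi t d i x = 0 := by
  induction d generalizing i with
  | zero =>
    simp only [bspline]
    rw [if_neg]
    rintro (⟨h1, h2, h3⟩ | ⟨h1, h2, h3⟩) <;> linarith
  | succ d ih =>
    simp only [bspline]
    rw [ih h, ih (h.trans (ht (by omega)))]
    simp

lemma bspline_eq_zero_of_knot_eq (ht : Monotone t) {d i : ℕ} (h : t i = t (i + d + 1)) (x : ℝ) :
    bspline hi t d i x = 0 := by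
  induction d generalizing i with
  | zero =>
    simp only [bspline]
    rw [if_neg]
    simp only [add_zero] at h
    rintro (⟨h1, h2, h3⟩ | ⟨h1, h2, h3⟩) <;> linarith
  | succ d ih =>
    simp only [bspline]
    have h1 : t i ≤ t (i + d + 1) := ht (by omega)
    have h2 : t (i + d + 1) ≤ t (i + (d + 1) + 1) := ht (by omega)
    have h3 : t i ≤ t (i + 1) := ht (by omega)
    have h4 : t (i + 1) ≤ t (i + 1 + d + 1) := ht (by omega)
    have e : i + 1 + d + 1 = i + (d + 1) + 1 := by ring
    rw [e] at h4
    rw [ih (by linarith), ih (by rw [e]; linarith)]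
    simp

/-- The two weights add up to one unless the knots coincide, and then the B-spline itself vanishes.
This is where the convention 0 / 0 = 0 is harmless. -/
lemma bspline_weights (ht : Monotone t) (d i : ℕ) (x : ℝ) :
    (x - t i) / (t (i + d + 1) - t i) * bspline hi t d i x
      + (t (i + d + 1) - x) / (t (i + d + 1) - t i) * bspline hi t d i x = bspline hi t d i x := by
  rcases (ht (show i ≤ i + d + 1 by omega)).eq_or_lt with h | h
  · rw [bspline_eq_zero_of_knot_eq ht h]; simp
  · have : t (i + d + 1) - t i ≠ 0 := by linarith
    field_simp
    ring

lemma sum_bspline_zero (ht : Monotone t) {x : ℝ} {a K : ℕ} (hx : x ≤ hi) (ha : t a ≤ x)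
    (hahi : t a < hi) (hK : t K = hi) :
    ∑ i ∈ Finset.Ico a K, bspline hi t 0 i x = 1 := by
  have haK : a ≤ K := by
    by_contra h
    have := ht (not_le.1 h).le
    linarith
  rcases hx.lt_or_eq with hx | rfl
  -- The degree-zero pieces tile, so a partial sum only records whether `x` has been passed. The
  -- case x = hi below is the same with the other end-point convention.
  · have key : ∀ k, a ≤ k → ∑ i ∈ Finset.Ico a k, bspline hi t 0 i x
        = 1 - if t k ≤ x then 1 else 0 := by
      intro k hk
      induction k, hk using Nat.le_induction with
      | base => simp [ha]
      | succ k hk ih =>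
        rw [Finset.sum_Ico_succ_top hk, ih]
        have h1 : t k ≤ t (k + 1) := ht (by omega)
        simp only [bspline]
        split_ifs <;> grind
    rw [key K haK, if_neg (by linarith)]
    simp
  · have key : ∀ k, a ≤ k → ∑ i ∈ Finset.Ico a k, bspline x t 0 i x
        = 1 - if t k < x then 1 else 0 := by
      intro k hk
      induction k, hk using Nat.le_induction with
      | base => simp [hahi]
      | succ k hk ih =>
        rw [Finset.sum_Ico_succ_top hk, ih]
        have h1 : t k ≤ t (k + 1) := ht (by omega)
        simp only [bspline]
        split_ifs <;> grind
    rw [key K haK, if_neg (by linarith)]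
    simp

/-- Induction on the degree: the weights of one B-spline of degree d occur at two adjacent indices
of degree d + 1 and recombine after an index shift. The range starts at D - d because B-splines of
degree d with smaller index have their support end at or before `lo`. -/
lemma sum_bspline (ht : Monotone t) {x lo : ℝ} {D K : ℕ} (hlo : lo ≤ x) (hx : x ≤ hi)
    (hlohi : lo < hi) (hD : t D = lo) (hK : t K = hi) {d : ℕ} (hd : d ≤ D) :
    ∑ i ∈ Finset.Ico (D - d) K, bspline hi t d i x = 1 := by
  have hDK : D < K := by
    by_contra h
    have := ht (not_lt.1 h)
    linarith
  induction d with
  | zero => exact sum_bspline_zero ht hx (by rw [Nat.sub_zero, hD]; exact hlo) (by simpa [hD]) hK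
  | succ d ih =>
    obtain ⟨s, rfl⟩ : ∃ s, D = s + (d + 1) := ⟨D - (d + 1), by omega⟩
    have ih' := ih (by omega)
    rw [show s + (d + 1) - d = s + 1 by omega] at ih'
    rw [show s + (d + 1) - (d + 1) = s by omega]
    simp only [bspline]
    have e : ∀ i, i + d + 2 = i + 1 + d + 1 := fun i => by ring
    simp only [e]
    -- After the shift two unmatched boundary terms remain: index s, whose support ends at `lo`, and
    -- index K, whose support starts at `hi`.
    rw [Finset.sum_add_distrib, Finset.sum_Ico_add' (fun i => (t (i + d + 1) - x) /
      (t (i + d + 1) - t i) * bspline hi t d i x) s K 1,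
      Finset.sum_eq_sum_Ico_succ_bot (by omega : s < K),
      Finset.sum_Ico_succ_top (by omega : s + 1 ≤ K),
      bspline_eq_zero_of_hi_le ht hx hK.ge, bspline_eq_zero_of_le (d := d) (i := s) ht, mul_zero,
      mul_zero, zero_add, add_zero, ← Finset.sum_add_distrib]
    · rw [← ih']
      exact Finset.sum_congr rfl fun i _ => bspline_weights ht d i x
    · have hs : t (s + d + 1) = lo := hD
      rw [hs]
      rcases hlo.lt_or_eq with h | h
      · exact Or.inr h
      · exact Or.inl ⟨by linarith, h.le⟩

variable {lo : ℝ} {K : ℕ}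

/-- B-splines form a partition of unity. -/
lemma BSplineBasis.sum_eval (β : BSplineBasis lo hi K) (hlohi : lo < hi) {x : ℝ}
    (hx : x ∈ Set.Icc lo hi) : ∑ k, β.eval x k = 1 := by
  have h := sum_bspline β.mono hx.1 hx.2 hlohi β.knot_left β.knot_right le_rfl
  rw [Nat.sub_self, ← Finset.range_eq_Ico, ← Fin.sum_univ_eq_sum_range] at h
  exact h

lemma BSplineBasis.eval_ne_zero (β : BSplineBasis lo hi K) (hlohi : lo < hi) {x : ℝ}
    (hx : x ∈ Set.Icc lo hi) : β.eval x ≠ 0 := by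
  intro h
  have := β.sum_eval hlohi hx
  simp [h] at this

lemma BSplineBasis.measurable_eval (β : BSplineBasis lo hi K) : Measurable β.eval :=
  measurable_pi_lambda _ fun _ => measurable_bspline _ _ _ _

end Spline

/-! ## The matrix `I_q ⊗ βᵀ` -/

lemma kronRow_apply {q K : ℕ} (β : Fin K → ℝ) (l : Fin q) (s : Fin q × Fin K) :
    kronRow q β l s = if l = s.1 then β s.2 else 0 := by
  simp [kronRow, Matrix.kroneckerMap_apply, Matrix.one_apply]

lemma kronRow_mulVec {q K : ℕ} (β : Fin K → ℝ) (c : Fin q × Fin K → ℝ) (l : Fin q) :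
    (kronRow q β).mulVec c l = ∑ k, c (l, k) * β k := by
  simp only [Matrix.mulVec, dotProduct, kronRow_apply, Fintype.sum_prod_type, ite_mul, zero_mul]
  rw [Finset.sum_comm]
  simp [mul_comm]

lemma kronRow_transpose_mulVec {q K : ℕ} (β : Fin K → ℝ) (v : Fin q → ℝ) (s : Fin q × Fin K) :
    (kronRow q β).transpose.mulVec v s = v s.1 * β s.2 := by
  simp [Matrix.mulVec, dotProduct, kronRow_apply, mul_comm]

/-- A single nonzero basis value recovers the vector; this makes the limiting covariance
nonsingular. -/
lemma kronRow_transpose_mulVec_injective {q K : ℕ} {β : Fin K → ℝ} (hβ : β ≠ 0) :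
    Function.Injective (kronRow q β).transpose.mulVec := by
  intro v w h
  obtain ⟨k, hk⟩ := Function.ne_iff.1 hβ
  ext l
  have := congrFun h (l, k)
  rw [kronRow_transpose_mulVec, kronRow_transpose_mulVec] at this
  exact mul_right_cancel₀ hk this

end GVCMM

namespace GVCMM

/-! ## Convex functions close to a given function on a finite set -/

section Convexity

variable {E : Type*} [NormedAddCommGroup E] [NormedSpace ℝ E]

/-- Convex functions that are close to a continuous function on a suitable finite set are close to
it on a ball. -/
lemma exists_finset_forall_convexOn_close [FiniteDimensional ℝ E] {q : E → ℝ} (hq : Continuous q)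
    (R : ℝ) {ε : ℝ} (hε : 0 < ε) :
    ∃ S : Finset E, ∃ δ : ℝ, 0 < δ ∧ ∀ (D : Set E) (h : E → ℝ), ConvexOn ℝ D h → ↑S ⊆ D →
      (∀ s ∈ S, |h s - q s| ≤ δ) →
      Metric.closedBall 0 R ⊆ D ∧ ContinuousOn h (Metric.closedBall 0 R) ∧
        ∀ s ∈ Metric.closedBall (0 : E) R, |h s - q s| ≤ ε := by
  classical
  have : ProperSpace E := FiniteDimensional.proper_real E
  -- On the convex hull of `T` a convex function is bounded above by its maximum over `T`.
  obtain ⟨T, hT, -⟩ := (convex_closedBall (0 : E) (R + 2)).exists_subset_interior_convexHull_finset_of_isCompact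
    (isCompact_closedBall 0 (R + 2)) (t := Set.univ) univ_mem
  replace hT : Metric.closedBall (0 : E) (R + 2) ⊆ convexHull ℝ (T : Set E) :=
    hT.trans interior_subset
  obtain ⟨M₀, hM₀⟩ : ∃ M₀, ∀ s ∈ T, |q s| ≤ M₀ := by
    obtain ⟨M₀, h⟩ := (T.image fun s => |q s|).bddAbove
    exact ⟨M₀, fun s hs => h (Finset.mem_coe.2 (Finset.mem_image_of_mem _ hs))⟩
  -- The upper bound |M₀| + 1 becomes the lower bound -M through the midpoint inequality 2 h(0) ≤
  -- h(s) + h(-s); this is why 0 is put into the finite set.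
  set M : ℝ := |M₀| + 2 * |q 0| + 3 with hM
  have hMpos : 0 < M := by positivity
  obtain ⟨η, hη, hηq⟩ := Metric.uniformContinuousOn_iff.1
    ((isCompact_closedBall (0 : E) R).uniformContinuousOn_of_continuous hq.continuousOn)
    (ε / 3) (by positivity)
  -- Mesh of the net: `η` controls the oscillation of `q`, the other term that of `h`, whose
  -- Lipschitz constant is 2M on the ball of radius R + 1 (bound M, margin 1).
  set r : ℝ := min η (ε / (3 * (2 * M)))
  have hr : 0 < r := by positivity
  obtain ⟨N, hNsub, hNfin, hN⟩ := (isCompact_closedBall (0 : E) R).finite_cover_balls hr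
  lift N to Finset E using hNfin
  refine ⟨T ∪ N ∪ {0}, min 1 (ε / 3), by positivity, fun D h hh hSD hclose => ?_⟩
  simp only [Finset.mem_union, Finset.mem_singleton] at hclose
  have hTD : (T : Set E) ⊆ D := fun s hs => hSD (by simp [Finset.mem_coe.1 hs])
  have hball : Metric.closedBall (0 : E) (R + 2) ⊆ D :=
    hT.trans (convexHull_min hTD hh.1)
  have hupper : ∀ s ∈ Metric.closedBall (0 : E) (R + 2), h s ≤ |M₀| + 1 := by
    intro s hs
    obtain ⟨y, hy, hsy⟩ := hh.exists_ge_of_mem_convexHull hTD (hT hs)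
    have h1 := hclose y (by simp [Finset.mem_coe.1 hy])
    have h2 := hM₀ y hy
    have h3 := min_le_left 1 (ε / 3)
    have h4 := le_abs_self M₀
    have := abs_le.1 h1
    have := abs_le.1 h2
    linarith
  have hlower : ∀ s ∈ Metric.closedBall (0 : E) (R + 2), -M ≤ h s := by
    intro s hs
    have hs' : -s ∈ Metric.closedBall (0 : E) (R + 2) := by simpa using hs
    have h1 := hh.2 (hball hs) (hball hs') (show (0 : ℝ) ≤ 1 / 2 by norm_num)
      (show (0 : ℝ) ≤ 1 / 2 by norm_num) (by norm_num)
    simp only [smul_neg, add_neg_cancel, smul_eq_mul] at h1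
    have h2 := abs_le.1 (hclose 0 (by simp))
    have h3 := min_le_left 1 (ε / 3)
    have h4 := hupper _ hs'
    have h5 := neg_abs_le (q 0)
    linarith
  have habs : ∀ s, dist s 0 < R + 2 → |h s| ≤ M := fun s hs => by
    have hs' : s ∈ Metric.closedBall (0 : E) (R + 2) := hs.le
    have h1 := hupper s hs'
    have h5 := abs_nonneg (q 0)
    exact abs_le.2 ⟨hlower s hs', by linarith⟩
  have hlip := (hh.subset (Metric.ball_subset_closedBall.trans hball)
    (convex_ball 0 (R + 2))).lipschitzOnWith_of_abs_le one_pos habs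
  have hsub : Metric.closedBall (0 : E) R ⊆ Metric.ball 0 (R + 2 - 1) :=
    Metric.closedBall_subset_ball (by linarith)
  refine ⟨(Metric.closedBall_subset_closedBall (by linarith)).trans hball,
    hlip.continuousOn.mono hsub, fun s hs => ?_⟩
  obtain ⟨c, hc, hsc⟩ := Set.mem_iUnion₂.1 (hN hs)
  have h1 := hclose c (by simp [Finset.mem_coe.1 hc])
  have h2 := hηq s hs c (hNsub hc) (lt_of_lt_of_le hsc (min_le_left _ _))
  have h3 := hlip.dist_le_mul s (hsub hs) c (hsub (hNsub hc))
  rw [Real.coe_toNNReal _ (by positivity), div_one] at h3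
  have h4 : 2 * M * dist s c ≤ ε / 3 := by
    have : dist s c ≤ ε / (3 * (2 * M)) := (lt_of_lt_of_le hsc (min_le_right _ _)).le
    calc 2 * M * dist s c ≤ 2 * M * (ε / (3 * (2 * M))) := by gcongr
      _ = ε / 3 := by field_simp
  rw [Real.dist_eq] at h2 h3
  have h5 := min_le_right 1 (ε / 3)
  have e : h s - q s = (h s - h c) + (h c - q c) - (q s - q c) := by ring
  rw [e]
  have := abs_le.1 (h3.trans h4)
  have := abs_le.1 (h1.trans h5)
  have := abs_le.1 h2.le
  exact abs_le.2 ⟨by linarith, by linarith⟩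

/-- A convex function that is close to a function with a well-separated minimum has a minimizer,
and all its minimizers are close to that minimum. -/
lemma exists_isMinOn_and_forall_norm_sub_le [FiniteDimensional ℝ E] {D : Set E} {f g : E → ℝ}
    {s₀ : E} {κ δ ε : ℝ} (hf : ConvexOn ℝ D f) (hδ : 0 < δ)
    (hball : Metric.closedBall s₀ δ ⊆ D) (hcont : ContinuousOn f (Metric.closedBall s₀ δ))
    (hclose : ∀ s ∈ Metric.closedBall s₀ δ, |f s - g s| ≤ ε)
    (hg : ∀ s, g s₀ + κ * ‖s - s₀‖ ^ 2 ≤ g s) (hε : 2 * ε < κ * δ ^ 2) :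
    (∃ s ∈ D, IsMinOn f D s) ∧ ∀ s ∈ D, IsMinOn f D s → ‖s - s₀‖ ≤ δ := by
  have : ProperSpace E := FiniteDimensional.proper_real E
  have hs₀ : s₀ ∈ Metric.closedBall s₀ δ := Metric.mem_closedBall_self hδ.le
  have houtside : ∀ s ∈ D, δ < ‖s - s₀‖ → f s₀ < f s := by
    intro s hs hfar
    by_contra hle
    rw [not_lt] at hle
    have hpos : 0 < ‖s - s₀‖ := hδ.trans hfar
    -- The segment from `s₀` to a far point `s` with f s ≤ f s₀ crosses the sphere of radius δ at
    -- `z`. Convexity forces f z ≤ f s₀, against the growth of `g`.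
    set t : ℝ := δ / ‖s - s₀‖
    have ht0 : 0 < t := by positivity
    have ht1 : t ≤ 1 := (div_le_one hpos).2 hfar.le
    set z : E := (1 - t) • s₀ + t • s
    have hz : z - s₀ = t • (s - s₀) := by simp only [z]; module
    have hznorm : ‖z - s₀‖ = δ := by
      rw [hz, norm_smul, Real.norm_of_nonneg ht0.le]
      exact div_mul_cancel₀ _ hpos.ne'
    have hzball : z ∈ Metric.closedBall s₀ δ := by rw [mem_closedBall_iff_norm, hznorm]
    have h1 : f z ≤ f s₀ := by
      have := hf.2 (hball hs₀) hs (sub_nonneg.2 ht1) ht0.le (by ring)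
      simp only [smul_eq_mul] at this
      nlinarith
    have h2 := hg z
    rw [hznorm] at h2
    have := abs_le.1 (hclose z hzball)
    have := abs_le.1 (hclose s₀ hs₀)
    linarith
  constructor
  · obtain ⟨s, hs, hmin⟩ := (isCompact_closedBall s₀ δ).exists_isMinOn ⟨s₀, hs₀⟩ hcont
    refine ⟨s, hball hs, fun x hx => ?_⟩
    by_cases hxb : x ∈ Metric.closedBall s₀ δ
    · exact hmin hxb
    · rw [mem_closedBall_iff_norm, not_le] at hxb
      exact (hmin hs₀).trans (houtside x hx hxb).le
  · intro s hs hmin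
    by_contra h
    exact absurd (hmin (hball hs₀)) (not_le.2 (houtside s hs (not_le.1 h)))

end Convexity

end GVCMM

namespace GVCMM

/-! ## Cumulants of the exponential family -/

namespace ExpFamily

variable (F : ExpFamily)

/-- The measure `c(y, φ) base(dy)` of which the laws of the family are exponential tilts. -/
noncomputable def carrier : Measure ℝ := F.base.withDensity fun y => ENNReal.ofReal (F.c y)

variable {F} {θ : ℝ}

lemma lintegral_exp_carrier (hθ : θ ∈ F.Θ) :
    ∫⁻ y, ENNReal.ofReal (Real.exp (θ / F.φ * id y)) ∂F.carrier
      = ENNReal.ofReal (Real.exp (F.b θ / F.φ)) := by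
  have hc := F.c_measurable
  rw [carrier, lintegral_withDensity_eq_lintegral_mul _ (by fun_prop) (by fun_prop)]
  have : ∀ y, ((fun y => ENNReal.ofReal (F.c y)) *
      fun y => ENNReal.ofReal (Real.exp (θ / F.φ * id y))) y
      = ENNReal.ofReal (Real.exp (F.b θ / F.φ))
        * ENNReal.ofReal (F.c y * Real.exp ((y * θ - F.b θ) / F.φ)) := by
    intro y
    rw [Pi.mul_apply, ← ENNReal.ofReal_mul (F.c_nonneg y),
      ← ENNReal.ofReal_mul (Real.exp_pos _).le, mul_left_comm, ← Real.exp_add, id]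
    congr 3
    ring
  simp_rw [this]
  rw [lintegral_const_mul _ (by fun_prop), F.normalized θ hθ, mul_one]

lemma integrable_exp_carrier (hθ : θ ∈ F.Θ) :
    Integrable (fun y => Real.exp (θ / F.φ * id y)) F.carrier := by
  refine ⟨by fun_prop, ?_⟩
  rw [hasFiniteIntegral_iff_ofReal (ae_of_all _ fun _ => (Real.exp_pos _).le),
    lintegral_exp_carrier hθ]
  exact ENNReal.ofReal_lt_top

lemma mgf_carrier (hθ : θ ∈ F.Θ) :
    mgf id F.carrier (θ / F.φ) = Real.exp (F.b θ / F.φ) := by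
  rw [mgf, integral_eq_lintegral_of_nonneg_ae (ae_of_all _ fun _ => (Real.exp_pos _).le)
    (by fun_prop), lintegral_exp_carrier hθ, ENNReal.toReal_ofReal (Real.exp_pos _).le]

/-- Normalization alone determines `b` on Θ as a rescaled cumulant generating function; all
smoothness of `b` is drawn from the analyticity of the latter. -/
lemma b_eq_cgf (hθ : θ ∈ F.Θ) : F.b θ = F.φ * cgf id F.carrier (θ / F.φ) := by
  rw [cgf, mgf_carrier hθ, Real.log_exp]
  have := F.φ_pos.ne'
  field_simp

lemma div_mem_interior (hθ : θ ∈ F.Θ) :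
    θ / F.φ ∈ interior (integrableExpSet id F.carrier) := by
  have hφ := F.φ_pos.ne'
  refine mem_interior.2 ⟨(fun t => F.φ * t) ⁻¹' F.Θ, fun t ht => ?_,
    F.Θ_open.preimage (by fun_prop), by simpa [mul_div_cancel₀ _ hφ]⟩
  have := integrable_exp_carrier (F := F) ht
  rwa [mul_div_cancel_left₀ _ hφ] at this

/-- Reduces mean and variance of the response to derivatives of the cumulant generating function of
the carrier. -/
lemma law_eq_tilted (hθ : θ ∈ F.Θ) :
    F.law θ = F.carrier.tilted (fun y => θ / F.φ * id y) := by
  have hc := F.c_measurable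
  rw [law, Measure.tilted, carrier]
  change _ = (F.base.withDensity _).withDensity _
  rw [← withDensity_mul _ (by fun_prop) (by fun_prop)]
  congr 1
  ext y
  have h := mgf_carrier hθ
  rw [mgf, carrier] at h
  rw [Pi.mul_apply, h, ← ENNReal.ofReal_mul (F.c_nonneg y), density, ← Real.exp_sub, id]
  congr 3
  ring

lemma isProbabilityMeasure_law (hθ : θ ∈ F.Θ) : IsProbabilityMeasure (F.law θ) :=
  ⟨by rw [law, withDensity_apply _ MeasurableSet.univ, Measure.restrict_univ]
      exact F.normalized θ hθ⟩

lemma hasDerivAt_b (hθ : θ ∈ F.Θ) : HasDerivAt F.b (deriv (cgf id F.carrier) (θ / F.φ)) θ := by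
  have h1 : HasDerivAt (cgf id F.carrier) (deriv (cgf id F.carrier) (θ / F.φ)) (θ / F.φ) :=
    (analyticAt_cgf (div_mem_interior hθ)).differentiableAt.hasDerivAt
  have h2 : HasDerivAt (fun θ => F.φ * cgf id F.carrier (θ / F.φ))
      (deriv (cgf id F.carrier) (θ / F.φ)) θ := by
    convert! (h1.comp θ ((hasDerivAt_id θ).div_const F.φ)).const_mul F.φ using 1
    have := F.φ_pos.ne'
    field_simp
  refine h2.congr_of_eventuallyEq ?_
  filter_upwards [F.Θ_open.mem_nhds hθ] with x hx using b_eq_cgf hx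

lemma deriv_b (hθ : θ ∈ F.Θ) : deriv F.b θ = deriv (cgf id F.carrier) (θ / F.φ) :=
  (hasDerivAt_b hθ).deriv

lemma hasDerivAt_deriv_b_cgf (hθ : θ ∈ F.Θ) :
    HasDerivAt (deriv F.b) (iteratedDeriv 2 (cgf id F.carrier) (θ / F.φ) / F.φ) θ := by
  have h1 : HasDerivAt (deriv (cgf id F.carrier)) (iteratedDeriv 2 (cgf id F.carrier) (θ / F.φ))
      (θ / F.φ) := by
    rw [iteratedDeriv_succ, iteratedDeriv_one]
    exact (analyticAt_cgf (div_mem_interior hθ)).deriv.differentiableAt.hasDerivAt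
  have h2 : HasDerivAt (fun θ => deriv (cgf id F.carrier) (θ / F.φ))
      (iteratedDeriv 2 (cgf id F.carrier) (θ / F.φ) / F.φ) θ := by
    convert! h1.comp θ ((hasDerivAt_id θ).div_const F.φ) using 1
    ring
  refine h2.congr_of_eventuallyEq ?_
  filter_upwards [F.Θ_open.mem_nhds hθ] with x hx using deriv_b hx

lemma iteratedDeriv_two_b (hθ : θ ∈ F.Θ) :
    iteratedDeriv 2 F.b θ = iteratedDeriv 2 (cgf id F.carrier) (θ / F.φ) / F.φ := by
  rw [iteratedDeriv_succ, iteratedDeriv_one]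
  exact (hasDerivAt_deriv_b_cgf hθ).deriv

lemma hasDerivAt_deriv_b (hθ : θ ∈ F.Θ) :
    HasDerivAt (deriv F.b) (iteratedDeriv 2 F.b θ) θ := by
  rw [iteratedDeriv_two_b hθ]
  exact hasDerivAt_deriv_b_cgf hθ

lemma continuousOn_iteratedDeriv_two_b : ContinuousOn (iteratedDeriv 2 F.b) F.Θ := by
  intro θ hθ
  have h := ((analyticAt_cgf (div_mem_interior hθ)).deriv.deriv.continuousAt).comp
    (f := fun θ => θ / F.φ) (x := θ) (by fun_prop)
  have h' := (h.div_const F.φ).continuousWithinAt (s := F.Θ)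
  refine h'.congr (fun x hx => ?_) ?_
  · rw [iteratedDeriv_two_b hx, iteratedDeriv_succ, iteratedDeriv_one]; rfl
  · rw [iteratedDeriv_two_b hθ, iteratedDeriv_succ, iteratedDeriv_one]; rfl

lemma measurable_iteratedDeriv_two_b : Measurable (iteratedDeriv 2 F.b) := by
  rw [iteratedDeriv_succ]
  exact measurable_deriv _

lemma memLp_id_law (hθ : θ ∈ F.Θ) : MemLp id 2 (F.law θ) := by
  rw [law_eq_tilted hθ]
  exact memLp_tilted_mul (div_mem_interior hθ) 2

lemma integral_law (hθ : θ ∈ F.Θ) : ∫ y, y ∂F.law θ = deriv F.b θ := by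
  rw [deriv_b hθ, ← integral_tilted_mul_self (div_mem_interior hθ), law_eq_tilted hθ]
  rfl

/-- The variance is the second derivative of the cumulant generating function at θ/φ;
differentiating φ · cgf(θ/φ) twice leaves a factor 1/φ. -/
lemma variance_law (hθ : θ ∈ F.Θ) : Var[id; F.law θ] = F.φ * iteratedDeriv 2 F.b θ := by
  rw [iteratedDeriv_two_b hθ, law_eq_tilted hθ, variance_tilted_mul (div_mem_interior hθ),
    mul_div_cancel₀ _ F.φ_pos.ne']

lemma iteratedDeriv_two_b_nonneg (hθ : θ ∈ F.Θ) : 0 ≤ iteratedDeriv 2 F.b θ := by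
  have h := variance_nonneg id (F.law θ)
  rw [variance_law hθ] at h
  exact nonneg_of_mul_nonneg_right h F.φ_pos

lemma lintegral_sq_law (hθ : θ ∈ F.Θ) :
    ∫⁻ y, ENNReal.ofReal ((y - deriv F.b θ) ^ 2) ∂F.law θ
      = ENNReal.ofReal (F.φ * iteratedDeriv 2 F.b θ) := by
  have := isProbabilityMeasure_law hθ
  rw [← variance_law hθ, ofReal_variance (memLp_id_law hθ), evariance_eq_lintegral_ofReal]
  simp only [id, integral_law hθ]

lemma integral_sub_law (hθ : θ ∈ F.Θ) : ∫ y, (y - deriv F.b θ) ∂F.law θ = 0 := by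
  have := isProbabilityMeasure_law hθ
  have h : Integrable (fun y => y) (F.law θ) := (memLp_id_law hθ).integrable (by norm_num)
  rw [integral_sub h (integrable_const _), integral_law hθ]
  simp

/-- Needed to split the logarithm of the density into log c and the exponent, since `Real.log 0 = 0`
would spoil the likelihood. -/
lemma ae_c_pos_law : ∀ᵐ y ∂F.law θ, 0 < F.c y := by
  have hc := F.c_measurable
  have hd : Measurable (F.density θ) := by unfold density; fun_prop
  rw [law, ae_withDensity_iff (by fun_prop)]
  refine ae_of_all _ fun y hy => (F.c_nonneg y).lt_of_ne fun h => hy ?_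
  simp [density, ← h]

lemma convexOn_b : ConvexOn ℝ F.Θ F.b := by
  refine MonotoneOn.convexOn_of_deriv F.Θ_convex
    (fun θ hθ => (hasDerivAt_b hθ).continuousAt.continuousWithinAt)
    (fun θ hθ => (hasDerivAt_b (interior_subset hθ)).differentiableAt.differentiableWithinAt) ?_
  rw [F.Θ_open.interior_eq]
  refine monotoneOn_of_deriv_nonneg F.Θ_convex
    (fun θ hθ => (hasDerivAt_deriv_b hθ).continuousAt.continuousWithinAt)
    (fun θ hθ => (hasDerivAt_deriv_b (interior_subset hθ)).differentiableAt.differentiableWithinAt)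
    fun θ hθ => ?_
  rw [(hasDerivAt_deriv_b (interior_subset hθ)).deriv]
  exact iteratedDeriv_two_b_nonneg (interior_subset hθ)

/-! ## Second-order Taylor remainder -/

variable (F) in
/-- The coefficient `∫ (1 - τ) b''(θ + τ k) dτ` of `k²` in the Taylor remainder of `b` at `θ`. -/
noncomputable def remainder (θ k : ℝ) : ℝ :=
  ∫ τ in Set.Ioc (0 : ℝ) 1, (1 - τ) * iteratedDeriv 2 F.b (θ + τ * k)

lemma remainder_zero (θ : ℝ) : F.remainder θ 0 = iteratedDeriv 2 F.b θ / 2 := by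
  simp only [remainder, mul_zero, add_zero]
  rw [← intervalIntegral.integral_of_le zero_le_one, intervalIntegral.integral_mul_const,
    intervalIntegral.integral_sub (by simp) (by simp)]
  simp
  ring

lemma segment_mem {k τ : ℝ} (hθ : θ ∈ F.Θ) (hk : θ + k ∈ F.Θ) (hτ : τ ∈ Set.Icc (0 : ℝ) 1) :
    θ + τ * k ∈ F.Θ := by
  have := F.Θ_convex.add_smul_sub_mem hθ hk hτ
  simpa using this

lemma continuousOn_remainder_integrand {k : ℝ} (hθ : θ ∈ F.Θ) (hk : θ + k ∈ F.Θ) :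
    ContinuousOn (fun τ => (1 - τ) * iteratedDeriv 2 F.b (θ + τ * k)) (Set.Icc (0 : ℝ) 1) := by
  refine ContinuousOn.mul (by fun_prop) ?_
  exact continuousOn_iteratedDeriv_two_b.comp (by fun_prop) fun τ hτ => segment_mem hθ hk hτ

lemma taylor_b {k : ℝ} (hθ : θ ∈ F.Θ) (hk : θ + k ∈ F.Θ) :
    F.b (θ + k) - F.b θ - deriv F.b θ * k = F.remainder θ k * k ^ 2 := by
  have h01 : (0 : ℝ) ≤ 1 := zero_le_one
  have hI : Set.uIcc (0 : ℝ) 1 = Set.Icc 0 1 := Set.uIcc_of_le h01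
  -- An explicit antiderivative of the remainder integrand; the two first-order terms cancel on
  -- differentiation.
  have hderiv : ∀ τ ∈ Set.uIcc (0 : ℝ) 1, HasDerivAt
      (fun τ => (1 - τ) * (deriv F.b (θ + τ * k) * k) + F.b (θ + τ * k))
      ((1 - τ) * iteratedDeriv 2 F.b (θ + τ * k) * k ^ 2) τ := by
    intro τ hτ
    have hm := segment_mem hθ hk (hI ▸ hτ)
    have hlin : HasDerivAt (fun τ => θ + τ * k) k τ := by
      simpa using ((hasDerivAt_id τ).mul_const k).const_add θ
    have h1 := ((hasDerivAt_deriv_b hm).comp τ hlin).mul_const k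
    have h2 := (hasDerivAt_b hm).comp τ hlin
    have h3 := (((hasDerivAt_id τ).const_sub 1).mul h1).add h2
    convert! h3 using 1
    simp only [Function.comp_apply, id, deriv_b hm]
    ring
  have hint : IntervalIntegrable (fun τ => (1 - τ) * iteratedDeriv 2 F.b (θ + τ * k) * k ^ 2)
      volume 0 1 := by
    refine ContinuousOn.intervalIntegrable ?_
    rw [hI]
    exact (continuousOn_remainder_integrand hθ hk).mul continuousOn_const
  have h := intervalIntegral.integral_eq_sub_of_hasDerivAt hderiv hint
  rw [intervalIntegral.integral_mul_const, intervalIntegral.integral_of_le h01] at h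
  rw [remainder, h]
  simp
  ring

lemma remainder_nonneg {k : ℝ} (hθ : θ ∈ F.Θ) (hk : θ + k ∈ F.Θ) : 0 ≤ F.remainder θ k :=
  setIntegral_nonneg measurableSet_Ioc fun τ hτ => mul_nonneg (by linarith [hτ.2])
    (iteratedDeriv_two_b_nonneg (segment_mem hθ hk (Set.Ioc_subset_Icc_self hτ)))

/-- The form in which Tonelli's theorem can exchange the remainder integral with the expectation. -/
lemma ofReal_remainder {k : ℝ} (hθ : θ ∈ F.Θ) (hk : θ + k ∈ F.Θ) :
    ENNReal.ofReal (F.remainder θ k) = ∫⁻ τ in Set.Ioc (0 : ℝ) 1,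
      ENNReal.ofReal ((1 - τ) * iteratedDeriv 2 F.b (θ + τ * k)) := by
  refine ofReal_integral_eq_lintegral_ofReal ?_ ?_
  · exact (continuousOn_remainder_integrand hθ hk).integrableOn_Icc.mono_set
      Set.Ioc_subset_Icc_self
  · refine (ae_restrict_iff' measurableSet_Ioc).2 (ae_of_all _ fun τ hτ => ?_)
    exact mul_nonneg (by linarith [hτ.2])
      (iteratedDeriv_two_b_nonneg (segment_mem hθ hk (Set.Ioc_subset_Icc_self hτ)))

lemma measurable_remainder : Measurable fun x : ℝ × ℝ => F.remainder x.1 x.2 := by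
  have h := measurable_iteratedDeriv_two_b (F := F)
  have : StronglyMeasurable fun p : (ℝ × ℝ) × ℝ =>
      (1 - p.2) * iteratedDeriv 2 F.b (p.1.1 + p.2 * p.1.2) :=
    Measurable.stronglyMeasurable (by fun_prop)
  exact (this.integral_prod_right' (ν := volume.restrict (Set.Ioc (0 : ℝ) 1))).measurable

lemma tendsto_remainder (hθ : θ ∈ F.Θ) :
    Tendsto (F.remainder θ) (𝓝 0) (𝓝 (iteratedDeriv 2 F.b θ / 2)) := by
  have hcont : ContinuousAt (iteratedDeriv 2 F.b) θ :=
    continuousOn_iteratedDeriv_two_b.continuousAt (F.Θ_open.mem_nhds hθ)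
  rw [Metric.tendsto_nhds]
  intro ε hε
  obtain ⟨δ, hδ, hball⟩ := Metric.mem_nhds_iff.1 (inter_mem (F.Θ_open.mem_nhds hθ)
    (Metric.continuousAt_iff'.1 hcont (ε / 2) (by positivity)))
  filter_upwards [Metric.ball_mem_nhds (0 : ℝ) hδ] with k hk
  have hmem : ∀ τ ∈ Set.Icc (0 : ℝ) 1, θ + τ * k ∈ Metric.ball θ δ := by
    intro τ hτ
    rw [Metric.mem_ball, Real.dist_eq] at *
    rw [add_sub_cancel_left, abs_mul, abs_of_nonneg hτ.1]
    rw [sub_zero] at hk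
    exact (mul_le_of_le_one_left (abs_nonneg k) hτ.2).trans_lt hk
  have hkΘ : θ + k ∈ F.Θ := by simpa using (hball (hmem 1 (by simp))).1
  have hint := (continuousOn_remainder_integrand hθ hkΘ).integrableOn_Icc.mono_set
    (Set.Ioc_subset_Icc_self) (μ := volume)
  have hint' : IntegrableOn (fun τ : ℝ => (1 - τ) * iteratedDeriv 2 F.b (θ + τ * 0)) (Set.Ioc 0 1) :=
    (ContinuousOn.integrableOn_Icc (by simp only [mul_zero, add_zero]; fun_prop)).mono_set Set.Ioc_subset_Icc_self
  rw [Real.dist_eq, ← remainder_zero, remainder, remainder, ← integral_sub hint hint', ← Real.norm_eq_abs]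
  refine (norm_setIntegral_le_of_norm_le_const (C := ε / 2) (by simp) fun τ hτ => ?_).trans_lt ?_
  · rw [← mul_sub, norm_mul, Real.norm_of_nonneg (by linarith [hτ.2])]
    have h1 := (hball (hmem τ (Set.Ioc_subset_Icc_self hτ))).2
    rw [Set.mem_ofPred_eq, dist_eq_norm] at h1
    rw [mul_zero, add_zero]
    calc (1 - τ) * ‖_‖ ≤ 1 * ‖_‖ := by gcongr; linarith [hτ.1]
      _ ≤ ε / 2 := by rw [one_mul]; exact h1.le
  · simp only [measureReal_def, Real.volume_Ioc, sub_zero, ENNReal.toReal_ofReal zero_le_one]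
    linarith

end ExpFamily

end GVCMM

namespace GVCMM

/-! ## Minimizers of random convex functions -/

/-- If the random convex functions `h n` converge pointwise in probability to `q`, then minimizers
of their perturbations `h n - ℓ n` by linear functionals are asymptotically equivalent to the
minimizers `s₀ n` of `q - ℓ n`, provided that these are stochastically bounded. -/
theorem tendstoInMeasure_argmin_sub {Ω : Type*} [MeasurableSpace Ω] {P : Measure Ω}
    {E : Type*} [NormedAddCommGroup E] [NormedSpace ℝ E] [FiniteDimensional ℝ E]
    {D : ℕ → Ω → Set E} {h : ℕ → Ω → E → ℝ} {ℓ : ℕ → Ω → E →ₗ[ℝ] ℝ} {q : E → ℝ}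
    {s₀ est : ℕ → Ω → E} {κ : ℝ} (hκ : 0 < κ) (hq : Continuous q)
    (hconv : ∀ n, ∀ᵐ ω ∂P, ConvexOn ℝ (D n ω) (h n ω))
    (hmem : ∀ s, ∀ᶠ n in atTop, ∀ᵐ ω ∂P, s ∈ D n ω)
    (hlim : ∀ s, TendstoInMeasure P (fun n ω => h n ω s) atTop (fun _ => q s))
    (hmin : ∀ n ω s, q (s₀ n ω) - ℓ n ω (s₀ n ω) + κ * ‖s - s₀ n ω‖ ^ 2 ≤ q s - ℓ n ω s)
    (htight : ∀ ε : ENNReal, 0 < ε → ∃ R : ℝ, ∀ n, P {ω | R ≤ ‖s₀ n ω‖} ≤ ε)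
    (hest : ∀ᶠ n in atTop, ∀ᵐ ω ∂P,
      (∃ s ∈ D n ω, IsMinOn (fun s => h n ω s - ℓ n ω s) (D n ω) s) →
        est n ω ∈ D n ω ∧ IsMinOn (fun s => h n ω s - ℓ n ω s) (D n ω) (est n ω)) :
    TendstoInMeasure P (fun n ω => est n ω - s₀ n ω) atTop 0 := by
  rw [tendstoInMeasure_iff_norm]
  intro δ hδ
  rw [ENNReal.tendsto_nhds_zero]
  intro η hη
  obtain ⟨R, hR⟩ := htight (η / 2) (ENNReal.half_pos hη.ne')
  -- Balls of radius δ/2 around `s₀` stay inside radius R + δ when ‖s₀‖ < R. The tolerance is chosen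
  -- so that twice it is below κ(δ/2)²; radius δ/2 gives a strict contradiction with distance at
  -- least δ.
  obtain ⟨S, r, hr, hS⟩ := exists_finset_forall_convexOn_close hq (R + δ)
    (ε := κ * (δ / 2) ^ 2 / 4) (by positivity)
  have hsum : Tendsto (fun n => ∑ s ∈ S, P {ω | r ≤ ‖h n ω s - q s‖}) atTop (𝓝 0) := by
    rw [← Finset.sum_const_zero (s := S)]
    exact tendsto_finsetSum _ fun s _ => (tendstoInMeasure_iff_norm.1 (hlim s)) r hr
  have hSmem : ∀ᶠ n in atTop, ∀ s ∈ S, ∀ᵐ ω ∂P, s ∈ D n ω :=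
    (Finset.eventually_all S).2 fun s _ => hmem s
  filter_upwards [ENNReal.tendsto_nhds_zero.1 hsum (η / 2) (ENNReal.half_pos hη.ne'), hSmem, hest]
    with n hn hnS hnest
  have hsub : ∀ᵐ ω ∂P, ω ∈ {ω | δ ≤ ‖est n ω - s₀ n ω - (0 : Ω → E) ω‖} →
      ω ∈ {ω | R ≤ ‖s₀ n ω‖} ∪ ⋃ s ∈ S, {ω | r ≤ ‖h n ω s - q s‖} := by
    filter_upwards [hconv n, (ae_ball_iff S.countable_toSet).2 hnS, hnest] with ω hω hωS hωest hbad
    by_contra hgood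
    simp only [Set.mem_union, Set.mem_iUnion, Set.mem_ofPred_eq, not_or, not_exists, not_le,
      Pi.zero_apply, sub_zero] at hgood hbad
    obtain ⟨hball, hcont, hclose⟩ := hS (D n ω) (h n ω) hω hωS fun s hs => (hgood.2 s hs).le
    have hsub : Metric.closedBall (s₀ n ω) (δ / 2) ⊆ Metric.closedBall 0 (R + δ) := by
      refine Metric.closedBall_subset_closedBall' ?_
      rw [dist_zero_right]
      linarith [hgood.1]
    have hℓ : Continuous (ℓ n ω) := (ℓ n ω).continuous_of_finiteDimensional
    have hconvf : ConvexOn ℝ (D n ω) fun s => h n ω s - ℓ n ω s :=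
      hω.sub ((ℓ n ω).concaveOn hω.1)
    obtain ⟨hex, hall⟩ := exists_isMinOn_and_forall_norm_sub_le hconvf
      (g := fun s => q s - ℓ n ω s) (s₀ := s₀ n ω) (half_pos hδ) (hsub.trans hball)
      ((hcont.mono hsub).sub hℓ.continuousOn)
      (fun s hs => by simpa using hclose s (hsub hs)) (hmin n ω)
      (by nlinarith [mul_pos hκ (pow_pos (half_pos hδ) 2)])
    obtain ⟨h1, h2⟩ := hωest hex
    have := hall _ h1 h2
    linarith
  calc P {ω | δ ≤ ‖est n ω - s₀ n ω - (0 : Ω → E) ω‖}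
      ≤ P ({ω | R ≤ ‖s₀ n ω‖} ∪ ⋃ s ∈ S, {ω | r ≤ ‖h n ω s - q s‖}) := measure_mono_ae hsub
    _ ≤ P {ω | R ≤ ‖s₀ n ω‖} + ∑ s ∈ S, P {ω | r ≤ ‖h n ω s - q s‖} :=
      (measure_union_le _ _).trans (by gcongr; exact measure_biUnion_finset_le _ _)
    _ ≤ η / 2 + η / 2 := add_le_add (hR n) hn
    _ = η := ENNReal.add_halves η

end GVCMM

namespace GVCMM

/-! ## Convergence in mean and in measure -/

section Convergence

variable {Ω : Type*} [MeasurableSpace Ω] {P : Measure Ω}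

/-- **Scheffé's lemma**, with an asymptotic upper bound for the integrals. -/
lemma tendsto_integral_abs_sub_of_integral_le {α : Type*} {l : Filter α} [l.IsCountablyGenerated]
    {X : α → Ω → ℝ} {Y : Ω → ℝ} (hY : Integrable Y P) (hX : ∀ᶠ c in l, Integrable (X c) P)
    (hX0 : ∀ᶠ c in l, ∀ᵐ ω ∂P, 0 ≤ X c ω)
    (hlim : ∀ᵐ ω ∂P, Tendsto (fun c => X c ω) l (𝓝 (Y ω)))
    (hle : ∀ ε > 0, ∀ᶠ c in l, ∫ ω, X c ω ∂P ≤ ∫ ω, Y ω ∂P + ε) :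
    Tendsto (fun c => ∫ ω, |X c ω - Y ω| ∂P) l (𝓝 0) := by
  -- Nonnegativity of X bounds the positive part of Y - X by |Y|, so dominated convergence applies
  -- to this half without any envelope for X.
  have hpos : Tendsto (fun c => ∫ ω, max (Y ω - X c ω) 0 ∂P) l (𝓝 0) := by
    suffices h : Tendsto (fun c => ∫ ω, max (Y ω - X c ω) 0 ∂P) l (𝓝 (∫ _ω, (0 : ℝ) ∂P)) by
      rwa [integral_zero] at h
    refine tendsto_integral_filter_of_dominated_convergence (f := fun _ => (0 : ℝ))
      (fun ω => |Y ω|) ?_ ?_ hY.abs ?_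
    · filter_upwards [hX] with c hc using ((hY.sub hc).pos_part).aestronglyMeasurable
    · filter_upwards [hX0] with c hc
      filter_upwards [hc] with ω hω
      rw [Real.norm_of_nonneg (le_max_right _ _)]
      exact max_le (by linarith [le_abs_self (Y ω)]) (abs_nonneg _)
    · filter_upwards [hlim] with ω hω
      have := ((tendsto_const_nhds (x := Y ω)).sub hω).max (tendsto_const_nhds (x := (0 : ℝ)))
      simpa using this
  rw [Metric.tendsto_nhds] at hpos ⊢
  intro ε hε
  filter_upwards [hX, hpos (ε / 4) (by positivity), hle (ε / 4) (by positivity)] with c h1 h2 h3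
  -- The upper bound on ∫ X controls the signed part of this identity, and the previous limit
  -- controls the rest.
  have hid : ∀ ω, |X c ω - Y ω| = X c ω - Y ω + 2 * max (Y ω - X c ω) 0 := by
    intro ω
    rcases le_total (X c ω) (Y ω) with h | h
    · rw [abs_of_nonpos (by linarith), max_eq_left (by linarith)]; ring
    · rw [abs_of_nonneg (by linarith), max_eq_right (by linarith)]; ring
  have hd : Integrable (fun ω => max (Y ω - X c ω) 0) P := (hY.sub h1).pos_part
  rw [Real.dist_eq, sub_zero, abs_of_nonneg (integral_nonneg fun _ => abs_nonneg _)]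
  simp_rw [hid]
  have hs : Integrable (fun ω => X c ω - Y ω) P := h1.sub hY
  rw [integral_add hs (hd.const_mul 2), integral_sub h1 hY, integral_const_mul]
  rw [Real.dist_eq, sub_zero] at h2
  linarith [le_abs_self (∫ ω, max (Y ω - X c ω) 0 ∂P)]

lemma tendstoInMeasure_of_sub {E : Type*} [SeminormedAddCommGroup E] {f g : ℕ → Ω → E} {c : Ω → E}
    (h : TendstoInMeasure P (fun n ω => f n ω - g n ω) atTop 0) (hg : TendstoInMeasure P g atTop c) :
    TendstoInMeasure P f atTop c := by
  rw [tendstoInMeasure_iff_norm] at *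
  intro ε hε
  have h1 := (h (ε / 2) (by positivity)).add (hg (ε / 2) (by positivity))
  rw [add_zero] at h1
  refine tendsto_of_tendsto_of_tendsto_of_le_of_le tendsto_const_nhds h1 (fun _ => zero_le) ?_
  intro n
  refine (measure_mono fun ω hω => ?_).trans (measure_union_le _ _)
  by_contra hc
  simp only [Set.mem_union, Set.mem_ofPred_eq, not_or, not_le, Pi.zero_apply, sub_zero] at hω hc
  have := norm_add_le (f n ω - g n ω) (g n ω - c ω)
  rw [sub_add_sub_cancel] at this
  linarith [hc.1, hc.2]

lemma tendstoInMeasure_of_integral_abs_le {f : ℕ → Ω → ℝ} {r : ℕ → ℝ}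
    (hf : ∀ᶠ n in atTop, Integrable (f n) P) (hle : ∀ᶠ n in atTop, ∫ ω, |f n ω| ∂P ≤ r n)
    (hr : Tendsto r atTop (𝓝 0)) : TendstoInMeasure P f atTop 0 := by
  rw [tendstoInMeasure_iff_norm]
  intro ε hε
  have hr' : Tendsto (fun n => ENNReal.ofReal (r n / ε)) atTop (𝓝 0) := by
    have := ENNReal.tendsto_ofReal (hr.div_const ε)
    simpa using this
  refine tendsto_of_tendsto_of_tendsto_of_le_of_le' tendsto_const_nhds hr'
    (Eventually.of_forall fun _ => zero_le) ?_
  filter_upwards [hf, hle] with n h1 h2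
  have hint := h1.abs
  have hm := mul_meas_ge_le_integral_of_nonneg (ae_of_all P fun ω => abs_nonneg (f n ω)) hint ε
  have hfin : P {ω | ε ≤ |f n ω|} ≠ ⊤ := by
    have := hint.measure_norm_ge_lt_top hε
    simp only [Real.norm_eq_abs, abs_abs] at this
    exact this.ne
  simp only [Pi.zero_apply, sub_zero, Real.norm_eq_abs]
  rw [← ENNReal.ofReal_toReal hfin]
  refine ENNReal.ofReal_le_ofReal ?_
  rw [le_div_iff₀ hε, mul_comm]
  exact hm.trans h2

end Convergence

/-- A factor τ ≤ 1 only moves the point closer to `a`. The whole segment is needed because the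
Taylor remainder integrates over it. -/
lemma eventually_nhds_zero_forall_segment {E : Type*} [SeminormedAddCommGroup E]
    [NormedSpace ℝ E] {p : E → Prop} {a : E} (h : ∀ᶠ a' in 𝓝 a, p a')
    (s : E) : ∀ᶠ c in 𝓝 (0 : ℝ), ∀ τ ∈ Set.Icc (0 : ℝ) 1, p (a + (τ * c) • s) := by
  have hc : Tendsto (fun c : ℝ => a + c • s) (𝓝 0) (𝓝 a) := by
    have : Continuous fun c : ℝ => a + c • s := by fun_prop
    simpa using this.tendsto 0
  obtain ⟨δ, hδ, hball⟩ := Metric.eventually_nhds_iff.1 (hc.eventually h)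
  refine Metric.eventually_nhds_iff.2 ⟨δ, hδ, fun c hcδ τ hτ => hball ?_⟩
  rw [Real.dist_eq, sub_zero] at *
  rw [abs_mul, abs_of_nonneg hτ.1]
  exact (mul_le_of_le_one_left (abs_nonneg c) hτ.2).trans_lt hcδ

/-! ## Generalized linear models with random design -/

section GLM

variable {Ω : Type*} [MeasurableSpace Ω] {P : Measure Ω}
  {ι : Type*} [Fintype ι] {F : ExpFamily}

/-- The Fisher information `E {z zᵀ b''(aᵀ z)}` of one observation with design vector `z`. -/
noncomputable def designInfo (P : Measure Ω) (F : ExpFamily) (z : Ω → ι → ℝ) (a : ι → ℝ) :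
    Matrix ι ι ℝ :=
  weightedMoment P (fun ω => iteratedDeriv 2 F.b (a ⬝ᵥ z ω)) z z

/-- At the coefficients `a` the natural parameter lies in `Θ` and the information is finite. -/
def FiniteInfo (P : Measure Ω) (F : ExpFamily) (z : Ω → ι → ℝ) (a : ι → ℝ) : Prop :=
  (∀ᵐ ω ∂P, a ⬝ᵥ z ω ∈ F.Θ) ∧
    ∀ s t, Integrable (fun ω => z ω s * z ω t * iteratedDeriv 2 F.b (a ⬝ᵥ z ω)) P

variable {z : Ω → ι → ℝ} {a : ι → ℝ}

lemma sq_dotProduct_mul (v w : ι → ℝ) (r : ℝ) :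
    (v ⬝ᵥ w) ^ 2 * r = ∑ s, ∑ t, v s * (v t * (w s * w t * r)) := by
  rw [sq, dotProduct, Finset.sum_mul_sum, Finset.sum_mul]
  refine Finset.sum_congr rfl fun s _ => ?_
  rw [Finset.sum_mul]
  refine Finset.sum_congr rfl fun t _ => ?_
  ring

lemma FiniteInfo.integrable_sq (h : FiniteInfo P F z a) (v : ι → ℝ) :
    Integrable (fun ω => (v ⬝ᵥ z ω) ^ 2 * iteratedDeriv 2 F.b (a ⬝ᵥ z ω)) P := by
  simp_rw [sq_dotProduct_mul]
  exact integrable_finsetSum _ fun s _ => integrable_finsetSum _ fun t _ =>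
    ((h.2 s t).const_mul _).const_mul _

lemma FiniteInfo.integral_sq (h : FiniteInfo P F z a) (v : ι → ℝ) :
    ∫ ω, (v ⬝ᵥ z ω) ^ 2 * iteratedDeriv 2 F.b (a ⬝ᵥ z ω) ∂P
      = v ⬝ᵥ (designInfo P F z a).mulVec v := by
  simp_rw [sq_dotProduct_mul]
  rw [integral_finsetSum _ fun s _ => integrable_finsetSum _ fun t _ =>
    ((h.2 s t).const_mul _).const_mul _]
  rw [dotProduct]
  refine Finset.sum_congr rfl fun s _ => ?_
  rw [integral_finsetSum _ fun t _ => ((h.2 s t).const_mul _).const_mul _, Matrix.mulVec, dotProduct,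
    Finset.mul_sum]
  refine Finset.sum_congr rfl fun t _ => ?_
  rw [integral_const_mul, integral_const_mul, designInfo, weightedMoment, Matrix.of_apply]
  ring

lemma FiniteInfo.lintegral_sq (h : FiniteInfo P F z a) (v : ι → ℝ) :
    ∫⁻ ω, ENNReal.ofReal ((v ⬝ᵥ z ω) ^ 2 * iteratedDeriv 2 F.b (a ⬝ᵥ z ω)) ∂P
      = ENNReal.ofReal (v ⬝ᵥ (designInfo P F z a).mulVec v) := by
  rw [← h.integral_sq, ofReal_integral_eq_lintegral_ofReal (h.integrable_sq v)]
  filter_upwards [h.1] with ω hω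
  exact mul_nonneg (sq_nonneg _) (ExpFamily.iteratedDeriv_two_b_nonneg hω)

lemma FiniteInfo.posSemidef (h : FiniteInfo P F z a) : (designInfo P F z a).PosSemidef := by
  refine Matrix.PosSemidef.of_dotProduct_mulVec_nonneg ?_ fun v => ?_
  · ext s t
    simp only [designInfo, weightedMoment, Matrix.conjTranspose_apply, Matrix.of_apply, star_trivial]
    exact integral_congr_ae (ae_of_all _ fun ω => by ring)
  · rw [star_trivial, ← h.integral_sq]
    refine integral_nonneg_of_ae ?_
    filter_upwards [h.1] with ω hω
    exact mul_nonneg (sq_nonneg _) (ExpFamily.iteratedDeriv_two_b_nonneg hω)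

lemma lintegral_one_sub : ∫⁻ τ in Set.Ioc (0 : ℝ) 1, ENNReal.ofReal (1 - τ)
    = ENNReal.ofReal (1 / 2) := by
  have hint : IntegrableOn (fun τ : ℝ => 1 - τ) (Set.Ioc 0 1) :=
    (ContinuousOn.integrableOn_Icc (by fun_prop)).mono_set Set.Ioc_subset_Icc_self
  rw [← ofReal_integral_eq_lintegral_ofReal hint]
  · congr 1
    rw [← intervalIntegral.integral_of_le zero_le_one,
      intervalIntegral.integral_sub (by simp) (by simp)]
    simp
    norm_num
  · refine (ae_restrict_iff' measurableSet_Ioc).2 (ae_of_all _ fun τ hτ => ?_)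
    simp only [Pi.zero_apply]
    linarith [hτ.2]

/-- The second-order remainder of one observation in the direction `s` at scale `c`. -/
noncomputable def scaledRemainder (F : ExpFamily) (a s : ι → ℝ) (c : ℝ) (w : ι → ℝ) : ℝ :=
  F.remainder (a ⬝ᵥ w) (c * (s ⬝ᵥ w)) * (s ⬝ᵥ w) ^ 2

lemma measurable_scaledRemainder (s : ι → ℝ) (c : ℝ) : Measurable (scaledRemainder F a s c) := by
  have h1 : Measurable fun w : ι → ℝ => s ⬝ᵥ w := by unfold dotProduct; fun_prop
  have h2 : Measurable fun w : ι → ℝ => a ⬝ᵥ w := by unfold dotProduct; fun_prop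
  exact (ExpFamily.measurable_remainder.comp (h2.prodMk (h1.const_mul c))).mul (h1.pow_const 2)

lemma dotProduct_segment (a s w : ι → ℝ) (c : ℝ) :
    (a + c • s) ⬝ᵥ w = a ⬝ᵥ w + c * (s ⬝ᵥ w) := by
  rw [add_dotProduct, smul_dotProduct, smul_eq_mul]

/-- By Tonelli the expectation can be taken first; it yields the quadratic form of the information
at a + τcs, and the weight 1 - τ integrates to 1/2. Only a bound on the information along the
segment is used. -/
lemma lintegral_scaledRemainder_le [SFinite P] (hz : Measurable z) {s : ι → ℝ} {c C : ℝ}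
    (h : ∀ τ ∈ Set.Icc (0 : ℝ) 1, FiniteInfo P F z (a + (τ * c) • s) ∧
      s ⬝ᵥ (designInfo P F z (a + (τ * c) • s)).mulVec s ≤ C) :
    ∫⁻ ω, ENNReal.ofReal (scaledRemainder F a s c (z ω)) ∂P ≤ ENNReal.ofReal (C / 2) := by
  have h0 := (h 0 (by simp)).1.1
  have h1 := (h 1 (by simp)).1.1
  have hsz : Measurable fun ω => s ⬝ᵥ z ω := by unfold dotProduct; fun_prop
  have haz : Measurable fun ω => a ⬝ᵥ z ω := by unfold dotProduct; fun_prop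
  have hb := ExpFamily.measurable_iteratedDeriv_two_b (F := F)
  have step : ∀ᵐ ω ∂P, ENNReal.ofReal (scaledRemainder F a s c (z ω))
      = ∫⁻ τ in Set.Ioc (0 : ℝ) 1, ENNReal.ofReal ((1 - τ) *
        iteratedDeriv 2 F.b (a ⬝ᵥ z ω + τ * (c * (s ⬝ᵥ z ω)))) * ENNReal.ofReal ((s ⬝ᵥ z ω) ^ 2) := by
    filter_upwards [h0, h1] with ω hω0 hω1
    simp only [zero_mul, zero_smul, add_zero, one_mul, dotProduct_segment] at hω0 hω1
    rw [scaledRemainder, ENNReal.ofReal_mul (ExpFamily.remainder_nonneg hω0 hω1),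
      ExpFamily.ofReal_remainder hω0 hω1, lintegral_mul_const _ (by fun_prop)]
  rw [lintegral_congr_ae step, lintegral_lintegral_swap (Measurable.aemeasurable (by fun_prop))]
  calc _ ≤ ∫⁻ τ in Set.Ioc (0 : ℝ) 1, ENNReal.ofReal (1 - τ) * ENNReal.ofReal C := by
        refine setLIntegral_mono' measurableSet_Ioc fun τ hτ => ?_
        obtain ⟨hτ1, hτ2⟩ := h τ (Set.Ioc_subset_Icc_self hτ)
        have hτ0 : 0 ≤ 1 - τ := by linarith [hτ.2]
        calc _ = ENNReal.ofReal (1 - τ) * ∫⁻ ω, ENNReal.ofReal ((s ⬝ᵥ z ω) ^ 2 *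
              iteratedDeriv 2 F.b ((a + (τ * c) • s) ⬝ᵥ z ω)) ∂P := by
              simp only [dotProduct_segment]
              rw [← lintegral_const_mul _ (by fun_prop)]
              refine lintegral_congr fun ω => ?_
              rw [ENNReal.ofReal_mul hτ0, mul_assoc, ← ENNReal.ofReal_mul' (sq_nonneg _),
                mul_comm (iteratedDeriv _ _ _), mul_assoc τ]
          _ ≤ _ := by
              rw [hτ1.lintegral_sq]
              gcongr
    _ = ENNReal.ofReal (1 / 2) * ENNReal.ofReal C := by
        rw [lintegral_mul_const _ (by fun_prop), lintegral_one_sub]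
    _ = ENNReal.ofReal (C / 2) := by
        rw [← ENNReal.ofReal_mul (by norm_num)]
        congr 1
        ring

/-- The scaled second-order remainder converges in mean to half the quadratic form. -/
lemma tendsto_integral_scaledRemainder [SFinite P] (hz : Measurable z)
    (hreg : ∀ᶠ a' in 𝓝 a, FiniteInfo P F z a') (hcont : ContinuousAt (designInfo P F z) a)
    (s : ι → ℝ) :
    (∀ᶠ c in 𝓝 (0 : ℝ), Integrable (fun ω => scaledRemainder F a s c (z ω)) P) ∧
    Tendsto (fun c => ∫ ω, |scaledRemainder F a s c (z ω) - scaledRemainder F a s 0 (z ω)| ∂P)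
      (𝓝 0) (𝓝 0) ∧
    Integrable (fun ω => scaledRemainder F a s 0 (z ω)) P ∧
    ∫ ω, scaledRemainder F a s 0 (z ω) ∂P = s ⬝ᵥ (designInfo P F z a).mulVec s / 2 := by
  have ha := hreg.self_of_nhds
  set Q := s ⬝ᵥ (designInfo P F z a).mulVec s
  have hzero : ∀ᵐ ω ∂P, scaledRemainder F a s 0 (z ω)
      = (s ⬝ᵥ z ω) ^ 2 * iteratedDeriv 2 F.b (a ⬝ᵥ z ω) / 2 := by
    filter_upwards [ha.1] with ω hω
    rw [scaledRemainder, zero_mul, ExpFamily.remainder_zero]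
    ring
  have hint0 : Integrable (fun ω => scaledRemainder F a s 0 (z ω)) P :=
    ((ha.integrable_sq s).div_const 2).congr (hzero.mono fun ω h => h.symm)
  have hval0 : ∫ ω, scaledRemainder F a s 0 (z ω) ∂P = Q / 2 := by
    rw [integral_congr_ae hzero, integral_div, ha.integral_sq]
  have hQ : 0 ≤ Q := by simpa using ha.posSemidef.dotProduct_mulVec_nonneg s
  have hmem : ∀ᶠ c in 𝓝 (0 : ℝ), ∀ᵐ ω ∂P, a ⬝ᵥ z ω ∈ F.Θ ∧ a ⬝ᵥ z ω + c * (s ⬝ᵥ z ω) ∈ F.Θ := by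
    filter_upwards [eventually_nhds_zero_forall_segment hreg s] with c hc
    filter_upwards [ha.1, (hc 1 (by simp)).1] with ω h0 h1
    rw [one_mul, dotProduct_segment] at h1
    exact ⟨h0, h1⟩
  have hnonneg : ∀ᶠ c in 𝓝 (0 : ℝ), ∀ᵐ ω ∂P, 0 ≤ scaledRemainder F a s c (z ω) := by
    filter_upwards [hmem] with c hc
    filter_upwards [hc] with ω hω
    exact mul_nonneg (ExpFamily.remainder_nonneg hω.1 hω.2) (sq_nonneg _)
  have hquad : ContinuousAt (fun a' => s ⬝ᵥ (designInfo P F z a').mulVec s) a := by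
    have : Continuous fun M : Matrix ι ι ℝ => s ⬝ᵥ M.mulVec s := by fun_prop
    exact this.continuousAt.comp hcont
  -- Continuity of the information at `a` keeps its quadratic form below Q + ε on the whole short
  -- segment.
  have hbound : ∀ ε > 0, ∀ᶠ c in 𝓝 (0 : ℝ),
      ∫⁻ ω, ENNReal.ofReal (scaledRemainder F a s c (z ω)) ∂P ≤ ENNReal.ofReal ((Q + ε) / 2) := by
    intro ε hε
    have h1 : ∀ᶠ a' in 𝓝 a, FiniteInfo P F z a' ∧
        s ⬝ᵥ (designInfo P F z a').mulVec s ≤ Q + ε := by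
      filter_upwards [hreg, hquad.eventually (gt_mem_nhds (show Q < Q + ε by linarith))]
        with a' h h' using ⟨h, h'.le⟩
    filter_upwards [eventually_nhds_zero_forall_segment h1 s] with c hc
    exact lintegral_scaledRemainder_le hz hc
  have hmeas : ∀ c, Measurable fun ω => scaledRemainder F a s c (z ω) := fun c =>
    (measurable_scaledRemainder s c).comp hz
  have hint : ∀ᶠ c in 𝓝 (0 : ℝ), Integrable (fun ω => scaledRemainder F a s c (z ω)) P := by
    filter_upwards [hnonneg, hbound 1 one_pos] with c h1 h2
    refine ⟨(hmeas c).aestronglyMeasurable, ?_⟩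
    rw [hasFiniteIntegral_iff_ofReal h1]
    exact h2.trans_lt ENNReal.ofReal_lt_top
  refine ⟨hint, ?_, hint0, hval0⟩
  refine tendsto_integral_abs_sub_of_integral_le hint0 hint hnonneg ?_ fun ε hε => ?_
  · filter_upwards [ha.1] with ω hω
    have h1 := ExpFamily.tendsto_remainder hω
    have h2 : Tendsto (fun c : ℝ => c * (s ⬝ᵥ z ω)) (𝓝 0) (𝓝 0) := by
      have : Continuous fun c : ℝ => c * (s ⬝ᵥ z ω) := by fun_prop
      simpa using this.tendsto 0
    have h3 := (h1.comp h2).mul_const ((s ⬝ᵥ z ω) ^ 2)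
    simp only [scaledRemainder, zero_mul, ExpFamily.remainder_zero]
    exact h3
  · filter_upwards [hnonneg, hbound ε hε] with c h1 h2
    rw [hval0, integral_eq_lintegral_of_nonneg_ae h1 (hmeas c).aestronglyMeasurable]
    refine (ENNReal.toReal_mono ENNReal.ofReal_ne_top h2).trans ?_
    rw [ENNReal.toReal_ofReal (by positivity)]
    linarith

end GLM

end GVCMM

namespace GVCMM

/-! ### Score sums and local loss of an i.i.d. sample. -/

section GLMSample

variable {Ω : Type*} [MeasurableSpace Ω] {P : Measure Ω} {ι : Type*} [Fintype ι] {F : ExpFamily}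

/-- The score `(y - b'(aᵀ z)) vᵀ z` of one observation in the direction `v`. -/
noncomputable def score (F : ExpFamily) (a v : ι → ℝ) (w : (ι → ℝ) × ℝ) : ℝ :=
  (w.2 - deriv F.b (a ⬝ᵥ w.1)) * (v ⬝ᵥ w.1)

lemma measurable_score (a v : ι → ℝ) : Measurable (score F a v) := by
  have hb := measurable_deriv F.b
  unfold score dotProduct
  fun_prop

/-- A random-design generalized linear model with canonical link and true coefficients `a` that is
regular at `a`. -/
structure RegularGLM (P : Measure Ω) (F : ExpFamily) (a : ι → ℝ) (z : ℕ → Ω → ι → ℝ)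
    (y : ℕ → Ω → ℝ) : Prop where
  measurable_z : ∀ i, Measurable (z i)
  measurable_y : ∀ i, Measurable (y i)
  indep : iIndepFun (fun i ω => (z i ω, y i ω)) P
  ident : ∀ i, IdentDistrib (fun ω => (z i ω, y i ω)) (fun ω => (z 0 ω, y 0 ω)) P P
  finiteInfo : ∀ᶠ a' in 𝓝 a, FiniteInfo P F (z 0) a'
  continuousAt : ContinuousAt (designInfo P F (z 0)) a
  c_pos : ∀ᵐ ω ∂P, 0 < F.c (y 0 ω)
  memLp_score : ∀ v, MemLp (fun ω => score F a v (z 0 ω, y 0 ω)) 2 P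
  integral_score : ∀ v, ∫ ω, score F a v (z 0 ω, y 0 ω) ∂P = 0
  integral_score_sq : ∀ v, ∫ ω, score F a v (z 0 ω, y 0 ω) ^ 2 ∂P
    = F.φ * (v ⬝ᵥ (designInfo P F (z 0) a).mulVec v)

/-- The normalized sum of the score vectors of the first `n` observations. -/
noncomputable def scoreSum (F : ExpFamily) (a : ι → ℝ) (n : ℕ) (z : ℕ → ι → ℝ) (y : ℕ → ℝ) :
    ι → ℝ :=
  (√n)⁻¹ • ∑ i ∈ Finset.range n, (y i - deriv F.b (a ⬝ᵥ z i)) • z i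

/-- The second-order part of the negative log-likelihood (times `φ`) at the local parameter `s`. -/
noncomputable def localLoss (F : ExpFamily) (a : ι → ℝ) (n : ℕ) (z : ℕ → ι → ℝ) (s : ι → ℝ) : ℝ :=
  ∑ i ∈ Finset.range n, (F.b (a ⬝ᵥ z i + (√n)⁻¹ * (s ⬝ᵥ z i)) - F.b (a ⬝ᵥ z i)
    - deriv F.b (a ⬝ᵥ z i) * ((√n)⁻¹ * (s ⬝ᵥ z i)))

lemma dotProduct_scoreSum (a v : ι → ℝ) (n : ℕ) (z : ℕ → ι → ℝ) (y : ℕ → ℝ) :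
    v ⬝ᵥ scoreSum F a n z y
      = (√n)⁻¹ * ∑ i ∈ Finset.range n, score F a v (z i, y i) := by
  rw [scoreSum, dotProduct_smul, smul_eq_mul, dotProduct_sum]
  simp only [dotProduct_smul, smul_eq_mul, score]

lemma tendsto_inv_sqrt_natCast : Tendsto (fun n : ℕ => (√(n : ℝ))⁻¹) atTop (𝓝 0) :=
  tendsto_inv_atTop_zero.comp (Real.tendsto_sqrt_atTop.comp tendsto_natCast_atTop_atTop)

namespace RegularGLM

variable {a : ι → ℝ} {z : ℕ → Ω → ι → ℝ} {y : ℕ → Ω → ℝ}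

lemma ident_z (h : RegularGLM P F a z y) (i : ℕ) : IdentDistrib (z i) (z 0) P P :=
  (h.ident i).comp measurable_fst

lemma ae_forall_mem (h : RegularGLM P F a z y) {a' : ι → ℝ} (ha' : FiniteInfo P F (z 0) a') :
    ∀ᵐ ω ∂P, ∀ i, a' ⬝ᵥ z i ω ∈ F.Θ := by
  refine ae_all_iff.2 fun i => ?_
  have hm : Measurable fun w : ι → ℝ => a' ⬝ᵥ w := by unfold dotProduct; fun_prop
  exact (h.ident_z i).symm.ae_snd (p := fun w => a' ⬝ᵥ w ∈ F.Θ) (hm F.Θ_open.measurableSet) ha'.1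

lemma ae_forall_c_pos (h : RegularGLM P F a z y) : ∀ᵐ ω ∂P, ∀ i, 0 < F.c (y i ω) := by
  refine ae_all_iff.2 fun i => ?_
  have := (h.ident i).comp measurable_snd
  exact this.symm.ae_snd (p := fun t => 0 < F.c t) (F.c_measurable measurableSet_Ioi) h.c_pos

lemma eventually_ae_forall_mem (h : RegularGLM P F a z y) (s : ι → ℝ) :
    ∀ᶠ n : ℕ in atTop, ∀ᵐ ω ∂P, ∀ i, (a + (√(n : ℝ))⁻¹ • s) ⬝ᵥ z i ω ∈ F.Θ := by
  filter_upwards [tendsto_inv_sqrt_natCast.eventually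
    (eventually_nhds_zero_forall_segment h.finiteInfo s)] with n hn
  have := hn 1 (by simp)
  rw [one_mul] at this
  exact h.ae_forall_mem this

lemma measurable_scoreSum (h : RegularGLM P F a z y) (n : ℕ) :
    Measurable fun ω => scoreSum F a n (fun i => z i ω) (fun i => y i ω) := by
  have hb := measurable_deriv F.b
  have hz := h.measurable_z
  have hy := h.measurable_y
  unfold scoreSum dotProduct
  fun_prop

/-- The square of the increment in the Taylor formula supplies (√n)⁻² = 1/n, which turns the sum
into a mean. -/
lemma localLoss_eq_mean {a s : ι → ℝ} {n : ℕ} (hn : 0 < n) {z : ℕ → ι → ℝ}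
    (h0 : ∀ i, a ⬝ᵥ z i ∈ F.Θ) (h1 : ∀ i, (a + (√(n : ℝ))⁻¹ • s) ⬝ᵥ z i ∈ F.Θ) :
    localLoss F a n z s
      = (∑ i ∈ Finset.range n, scaledRemainder F a s (√(n : ℝ))⁻¹ (z i)) / n := by
  have hn0 : (0 : ℝ) < n := by exact_mod_cast hn
  rw [localLoss, Finset.sum_div]
  refine Finset.sum_congr rfl fun i _ => ?_
  have hk := h1 i
  rw [dotProduct_segment] at hk
  rw [ExpFamily.taylor_b (h0 i) hk, mul_pow, inv_pow, Real.sq_sqrt hn0.le, scaledRemainder]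
  ring

/-- The scale changes with n, so the summands form a triangular array. Convergence in mean for one
observation suffices, because the mean absolute value of an average of identically distributed terms
is at most that of one term. -/
lemma tendstoInMeasure_mean_scaledRemainder_sub [SFinite P] (h : RegularGLM P F a z y) (s : ι → ℝ) :
    TendstoInMeasure P (fun (n : ℕ) ω => (∑ i ∈ Finset.range n,
      (scaledRemainder F a s (√(n : ℝ))⁻¹ (z i ω) - scaledRemainder F a s 0 (z i ω))) / n)
      atTop 0 := by
  obtain ⟨hint, hlim, hint0, -⟩ := tendsto_integral_scaledRemainder (h.measurable_z 0)
    h.finiteInfo h.continuousAt s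
  have hmR : ∀ c, Measurable (scaledRemainder F a s c) := measurable_scaledRemainder s
  have hc := tendsto_inv_sqrt_natCast
  have hidD : ∀ n i, IdentDistrib
      (fun ω => scaledRemainder F a s (√(n : ℝ))⁻¹ (z i ω) - scaledRemainder F a s 0 (z i ω))
      (fun ω => scaledRemainder F a s (√(n : ℝ))⁻¹ (z 0 ω) - scaledRemainder F a s 0 (z 0 ω)) P P :=
    fun n i => (h.ident_z i).comp ((hmR _).sub (hmR 0))
  have hintD : ∀ᶠ n : ℕ in atTop, ∀ i, Integrable
      (fun ω => scaledRemainder F a s (√(n : ℝ))⁻¹ (z i ω) - scaledRemainder F a s 0 (z i ω)) P := by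
    filter_upwards [hc.eventually hint] with n hn i
    exact (hidD n i).integrable_iff.2 (hn.sub hint0)
  refine tendstoInMeasure_of_integral_abs_le ?_ ?_ (hlim.comp hc)
  · filter_upwards [hintD] with n hn
    exact (integrable_finsetSum _ fun i _ => hn i).div_const _
  · filter_upwards [hintD, eventually_gt_atTop 0] with n hn hpos
    have hn0 : (0 : ℝ) < n := by exact_mod_cast hpos
    simp only [abs_div, Nat.abs_cast]
    rw [integral_div, div_le_iff₀ hn0]
    calc _ ≤ ∫ ω, ∑ i ∈ Finset.range n, |scaledRemainder F a s (√(n : ℝ))⁻¹ (z i ω)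
          - scaledRemainder F a s 0 (z i ω)| ∂P :=
          integral_mono (integrable_finsetSum _ fun i _ => hn i).abs
            (integrable_finsetSum _ fun i _ => (hn i).abs) fun ω => Finset.abs_sum_le_sum_abs _ _
      _ = ∑ i ∈ Finset.range n, ∫ ω, |scaledRemainder F a s (√(n : ℝ))⁻¹ (z 0 ω)
          - scaledRemainder F a s 0 (z 0 ω)| ∂P := by
          rw [integral_finsetSum _ fun i _ => (hn i).abs]
          exact Finset.sum_congr rfl fun i _ => ((hidD n i).comp measurable_abs).integral_eq
      _ = _ := by
          rw [Finset.sum_const, Finset.card_range, nsmul_eq_mul, mul_comm]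
          rfl

variable [IsProbabilityMeasure P]

lemma tendstoInMeasure_mean_scaledRemainder_zero (h : RegularGLM P F a z y) (s : ι → ℝ) :
    TendstoInMeasure P
      (fun (n : ℕ) ω => (∑ i ∈ Finset.range n, scaledRemainder F a s 0 (z i ω)) / n) atTop
      (fun _ => s ⬝ᵥ (designInfo P F (z 0) a).mulVec s / 2) := by
  obtain ⟨-, -, hint0, hval0⟩ := tendsto_integral_scaledRemainder (h.measurable_z 0)
    h.finiteInfo h.continuousAt s
  have hm : Measurable (scaledRemainder F a s 0) := measurable_scaledRemainder s 0
  have hm' : Measurable fun w : (ι → ℝ) × ℝ => scaledRemainder F a s 0 w.1 :=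
    hm.comp measurable_fst
  have hslln := strong_law_ae_real (fun i ω => scaledRemainder F a s 0 (z i ω)) hint0
    (fun i j hij => (h.indep.indepFun hij).comp hm' hm') fun i => (h.ident_z i).comp hm
  rw [hval0] at hslln
  refine tendstoInMeasure_of_tendsto_ae (fun n => ?_) hslln
  exact ((Finset.measurable_fun_sum _ fun i _ =>
    hm.comp (h.measurable_z i)).div_const _).aestronglyMeasurable

/-- The local loss converges pointwise in probability to half the quadratic form of the
information matrix. -/
lemma tendstoInMeasure_localLoss (h : RegularGLM P F a z y) (s : ι → ℝ) :
    TendstoInMeasure P (fun n ω => localLoss F a n (fun i => z i ω) s) atTop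
      (fun _ => s ⬝ᵥ (designInfo P F (z 0) a).mulVec s / 2) := by
  refine tendstoInMeasure_of_sub ?_ (h.tendstoInMeasure_mean_scaledRemainder_zero s)
  refine (h.tendstoInMeasure_mean_scaledRemainder_sub s).congr' ?_ EventuallyEq.rfl
  filter_upwards [h.eventually_ae_forall_mem s, eventually_gt_atTop 0] with n hn hpos
  filter_upwards [hn, h.ae_forall_mem h.finiteInfo.self_of_nhds] with ω h1 h0
  rw [localLoss_eq_mean hpos h0 h1, ← sub_div, ← Finset.sum_sub_distrib]

/-- Chebyshev's inequality; by independence the normalized sum has at most the variance of one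
summand, so the bound does not depend on n. -/
lemma measure_le_dotProduct_scoreSum (h : RegularGLM P F a z y) (v : ι → ℝ) (n : ℕ) {R : ℝ}
    (hR : 0 < R) :
    P {ω | R ≤ |v ⬝ᵥ scoreSum F a n (fun i => z i ω) (fun i => y i ω)|}
      ≤ ENNReal.ofReal (Var[fun ω => score F a v (z 0 ω, y 0 ω); P] / R ^ 2) := by
  have hid : ∀ i, IdentDistrib (fun ω => score F a v (z i ω, y i ω))
      (fun ω => score F a v (z 0 ω, y 0 ω)) P P := fun i => (h.ident i).comp (measurable_score a v)
  have hL2 : ∀ i, MemLp (fun ω => score F a v (z i ω, y i ω)) 2 P := fun i =>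
    (hid i).memLp_iff.2 (h.memLp_score v)
  set X : Ω → ℝ := fun ω => v ⬝ᵥ scoreSum F a n (fun i => z i ω) (fun i => y i ω)
  have hX : X = fun ω => (√n)⁻¹ * (∑ i ∈ Finset.range n, fun ω => score F a v (z i ω, y i ω)) ω := by
    ext ω
    simp only [X, dotProduct_scoreSum, Finset.sum_apply]
  have hsum : MemLp (∑ i ∈ Finset.range n, fun ω => score F a v (z i ω, y i ω)) 2 P :=
    memLp_finsetSum' _ fun i _ => hL2 i
  have hXL2 : MemLp X 2 P := by rw [hX]; exact hsum.const_mul _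
  have hmean : ∫ ω, X ω ∂P = 0 := by
    rw [hX, integral_const_mul]
    simp only [Finset.sum_apply]
    rw [integral_finsetSum _ fun i _ => (hL2 i).integrable (by norm_num),
      Finset.sum_eq_zero fun i _ => ((hid i).integral_eq.trans (h.integral_score v)), mul_zero]
  have hvar : Var[X; P] ≤ Var[fun ω => score F a v (z 0 ω, y 0 ω); P] := by
    rw [hX, variance_const_mul, IndepFun.variance_sum (fun i _ => hL2 i) fun i _ j _ hij =>
      (h.indep.indepFun hij).comp (measurable_score a v) (measurable_score a v),
      Finset.sum_congr rfl fun i _ => (hid i).variance_eq, Finset.sum_const, Finset.card_range,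
      nsmul_eq_mul, inv_pow, Real.sq_sqrt (Nat.cast_nonneg n), ← mul_assoc]
    -- An inequality and not an equality, since for n = 0 the factor n⁻¹ n is 0.
    exact mul_le_of_le_one_left (variance_nonneg _ _) (inv_mul_le_one)
  have hcheb := meas_ge_le_variance_div_sq hXL2 hR
  rw [hmean] at hcheb
  simp only [sub_zero] at hcheb
  refine hcheb.trans (ENNReal.ofReal_le_ofReal ?_)
  gcongr

lemma tight_mulVec_scoreSum (h : RegularGLM P F a z y) (M : Matrix ι ι ℝ) {ε : ENNReal}
    (hε : 0 < ε) : ∃ R : ℝ, ∀ n,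
      P {ω | R ≤ ‖M.mulVec (scoreSum F a n (fun i => z i ω) (fun i => y i ω))‖} ≤ ε := by
  set C : ℝ := ∑ j, Var[fun ω => score F a (M j) (z 0 ω, y 0 ω); P]
  have hlim : Tendsto (fun R : ℝ => ENNReal.ofReal (C / R ^ 2)) atTop (𝓝 0) := by
    have : Tendsto (fun R : ℝ => C / R ^ 2) atTop (𝓝 0) :=
      Tendsto.div_atTop tendsto_const_nhds (tendsto_pow_atTop two_ne_zero)
    simpa using ENNReal.tendsto_ofReal this
  obtain ⟨R, hRε, hR⟩ := ((ENNReal.tendsto_nhds_zero.1 hlim ε hε).and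
    (eventually_gt_atTop 0)).exists
  refine ⟨R, fun n => le_trans ?_ hRε⟩
  calc P {ω | R ≤ ‖M.mulVec (scoreSum F a n (fun i => z i ω) (fun i => y i ω))‖}
      ≤ P (⋃ j ∈ Finset.univ,
          {ω | R ≤ |M j ⬝ᵥ scoreSum F a n (fun i => z i ω) (fun i => y i ω)|}) := by
        refine measure_mono fun ω hω => ?_
        by_contra hc
        simp only [Set.mem_iUnion, Set.mem_ofPred_eq, not_exists, not_le, Finset.mem_univ,
          forall_const] at hω hc
        exact absurd hω (not_le.2 ((pi_norm_lt_iff hR).2 hc))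
    _ ≤ ∑ j, ENNReal.ofReal (Var[fun ω => score F a (M j) (z 0 ω, y 0 ω); P] / R ^ 2) :=
        (measure_biUnion_finset_le _ _).trans
          (Finset.sum_le_sum fun j _ => h.measure_le_dotProduct_scoreSum (M j) n hR)
    _ = ENNReal.ofReal (C / R ^ 2) := by
        rw [← ENNReal.ofReal_sum_of_nonneg fun j _ =>
          div_nonneg (variance_nonneg _ _) (sq_nonneg R), ← Finset.sum_div]

end RegularGLM

end GLMSample

end GVCMM

namespace GVCMM

/-! ### Local form of the likelihood and linear expansion of its maximizers. -/

section Estimation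

variable {Ω : Type*} [MeasurableSpace Ω] {P : Measure Ω} {ι : Type*} [Fintype ι] {F : ExpFamily}

/-- The coefficients for which the first `n` natural parameters lie in `Θ`. -/
def admissibleCoef (F : ExpFamily) (n : ℕ) (z : ℕ → ι → ℝ) : Set (ι → ℝ) :=
  {a | ∀ i < n, a ⬝ᵥ z i ∈ F.Θ}

/-- The log-likelihood of the first `n` observations with design vectors `z`. -/
noncomputable def designLogLik (F : ExpFamily) (n : ℕ) (z : ℕ → ι → ℝ) (y : ℕ → ℝ) (a : ι → ℝ) :
    ℝ :=
  ∑ i ∈ Finset.range n, Real.log (F.density (a ⬝ᵥ z i) (y i))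

/-- The linear functional `s ↦ sᵀ v`. -/
def dotProductRight (v : ι → ℝ) : (ι → ℝ) →ₗ[ℝ] ℝ where
  toFun s := s ⬝ᵥ v
  map_add' s t := add_dotProduct s t v
  map_smul' c s := smul_dotProduct c s v

/-- An exact identity: the canonical link makes the response enter the exponent linearly, so all
randomness of `y` goes into the linear term, and the rest depends on the design only. -/
lemma designLogLik_local (a s : ι → ℝ) (n : ℕ) (z : ℕ → ι → ℝ) {y : ℕ → ℝ}
    (hc : ∀ i, 0 < F.c (y i)) :
    designLogLik F n z y (a + (√(n : ℝ))⁻¹ • s) = designLogLik F n z y a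
      - (localLoss F a n z s - dotProductRight (scoreSum F a n z y) s) / F.φ := by
  have hφ := F.φ_pos.ne'
  change _ = _ - (_ - s ⬝ᵥ scoreSum F a n z y) / _
  rw [dotProduct_scoreSum, Finset.mul_sum, localLoss, ← Finset.sum_sub_distrib, Finset.sum_div,
    designLogLik, designLogLik, ← Finset.sum_sub_distrib]
  refine Finset.sum_congr rfl fun i _ => ?_
  rw [ExpFamily.density, ExpFamily.density, Real.log_mul (hc i).ne' (Real.exp_pos _).ne',
    Real.log_mul (hc i).ne' (Real.exp_pos _).ne', Real.log_exp, Real.log_exp, dotProduct_segment,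
    score]
  field_simp
  ring

/-- Each summand is the convex function `b` along an affine map, minus an affine function. -/
lemma convexOn_localLoss (a : ι → ℝ) (n : ℕ) (z : ℕ → ι → ℝ) :
    ConvexOn ℝ {s | a + (√(n : ℝ))⁻¹ • s ∈ admissibleCoef F n z} (localLoss F a n z) := by
  have hlin : ∀ (s t : ι → ℝ) (α β : ℝ), α + β = 1 → ∀ i,
      a ⬝ᵥ z i + (√(n : ℝ))⁻¹ * ((α • s + β • t) ⬝ᵥ z i)
        = α • (a ⬝ᵥ z i + (√(n : ℝ))⁻¹ * (s ⬝ᵥ z i))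
          + β • (a ⬝ᵥ z i + (√(n : ℝ))⁻¹ * (t ⬝ᵥ z i)) := by
    intro s t α β h i
    rw [add_dotProduct, smul_dotProduct, smul_dotProduct]
    simp only [smul_eq_mul]
    linear_combination -(a ⬝ᵥ z i) * h
  refine ⟨fun s hs t ht α β hα hβ hαβ i hi => ?_, fun s hs t ht α β hα hβ hαβ => ?_⟩
  · have h1 := hs i hi
    have h2 := ht i hi
    rw [dotProduct_segment] at *
    rw [hlin s t α β hαβ]
    exact F.Θ_convex h1 h2 hα hβ hαβ
  · rw [localLoss, localLoss, localLoss, smul_eq_mul, smul_eq_mul, Finset.mul_sum, Finset.mul_sum,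
      ← Finset.sum_add_distrib]
    refine Finset.sum_le_sum fun i hi => ?_
    have h1 := hs i (Finset.mem_range.1 hi)
    have h2 := ht i (Finset.mem_range.1 hi)
    rw [dotProduct_segment] at h1 h2
    have h3 := ExpFamily.convexOn_b.2 h1 h2 hα hβ hαβ
    rw [hlin s t α β hαβ, add_dotProduct, smul_dotProduct, smul_dotProduct]
    simp only [smul_eq_mul] at *
    linear_combination h3 + F.b (a ⬝ᵥ z i) * hαβ

/-- Compactness of the unit sphere and homogeneity. The sphere is empty when the index type is,
hence the separate case. -/
lemma exists_forall_sq_norm_le [DecidableEq ι] {M : Matrix ι ι ℝ} (hM : M.PosDef) :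
    ∃ κ > 0, ∀ x : ι → ℝ, κ * ‖x‖ ^ 2 ≤ x ⬝ᵥ M.mulVec x / 2 := by
  have hcont : Continuous fun x : ι → ℝ => x ⬝ᵥ M.mulVec x / 2 := by fun_prop
  rcases (Metric.sphere (0 : ι → ℝ) 1).eq_empty_or_nonempty with he | hne
  · refine ⟨1, one_pos, fun x => ?_⟩
    have hx : x = 0 := by
      by_contra hx
      have : ‖x‖⁻¹ • x ∈ Metric.sphere (0 : ι → ℝ) 1 := by
        rw [mem_sphere_zero_iff_norm, norm_smul, norm_inv, norm_norm,
          inv_mul_cancel₀ (norm_ne_zero_iff.2 hx)]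
      rw [he] at this
      exact this
    simp [hx]
  · obtain ⟨x₀, hx₀, hmin⟩ := (isCompact_sphere (0 : ι → ℝ) 1).exists_isMinOn hne hcont.continuousOn
    have hx₀0 : x₀ ≠ 0 := by
      rintro rfl
      simp at hx₀
    refine ⟨x₀ ⬝ᵥ M.mulVec x₀ / 2, ?_, fun x => ?_⟩
    · have := hM.dotProduct_mulVec_pos hx₀0
      rw [star_trivial] at this
      exact half_pos this
    · rcases eq_or_ne x 0 with rfl | hx
      · simp
      have hxn := norm_ne_zero_iff.2 hx
      have : ‖x‖⁻¹ • x ∈ Metric.sphere (0 : ι → ℝ) 1 := by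
        rw [mem_sphere_zero_iff_norm, norm_smul, norm_inv, norm_norm, inv_mul_cancel₀ hxn]
      have h := hmin this
      simp only [Set.mem_ofPred_eq, Matrix.mulVec_smul, smul_dotProduct, dotProduct_smul,
        smul_eq_mul] at h
      calc _ ≤ ‖x‖⁻¹ * (‖x‖⁻¹ * (x ⬝ᵥ M.mulVec x)) / 2 * ‖x‖ ^ 2 := by gcongr
        _ = _ := by field_simp

/-- Completing the square: M⁻¹U is the minimizer, and the excess over the minimum is half the
quadratic form of the deviation. -/
lemma half_quadratic_sub [DecidableEq ι] {M : Matrix ι ι ℝ} (hM : M.PosDef) (U s : ι → ℝ) :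
    s ⬝ᵥ M.mulVec s / 2 - s ⬝ᵥ U
      = (M⁻¹.mulVec U) ⬝ᵥ M.mulVec (M⁻¹.mulVec U) / 2 - (M⁻¹.mulVec U) ⬝ᵥ U
        + (s - M⁻¹.mulVec U) ⬝ᵥ M.mulVec (s - M⁻¹.mulVec U) / 2 := by
  have h1 : M.mulVec (M⁻¹.mulVec U) = U := by
    rw [Matrix.mulVec_mulVec, Matrix.mul_nonsing_inv _ ((Matrix.isUnit_iff_isUnit_det _).1 hM.isUnit),
      Matrix.one_mulVec]
  have hsymm : M.transpose = M := by
    have := hM.isHermitian.eq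
    rwa [Matrix.conjTranspose_eq_transpose_of_trivial] at this
  have h2 : (M⁻¹.mulVec U) ⬝ᵥ M.mulVec s = s ⬝ᵥ U := by
    rw [Matrix.dotProduct_mulVec, ← Matrix.mulVec_transpose, hsymm, h1, dotProduct_comm]
  rw [Matrix.mulVec_sub, h1, sub_dotProduct, dotProduct_sub, dotProduct_sub, h2]
  ring

/-- **Linear expansion of the maximum-likelihood estimator.** Vectors that maximize the likelihood
whenever a maximizer exists are asymptotically equivalent to the efficient score. -/
theorem RegularGLM.tendstoInMeasure_mle [IsProbabilityMeasure P] [DecidableEq ι] {a : ι → ℝ}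
    {z : ℕ → Ω → ι → ℝ} {y : ℕ → Ω → ℝ} (h : RegularGLM P F a z y)
    (hpd : (designInfo P F (z 0) a).PosDef) {est : ℕ → Ω → ι → ℝ}
    (hest : ∀ n, ∀ᵐ ω ∂P,
      (∃ a' ∈ admissibleCoef F n (fun i => z i ω),
        IsMaxOn (designLogLik F n (fun i => z i ω) (fun i => y i ω))
          (admissibleCoef F n (fun i => z i ω)) a') →
      est n ω ∈ admissibleCoef F n (fun i => z i ω) ∧
        IsMaxOn (designLogLik F n (fun i => z i ω) (fun i => y i ω))
          (admissibleCoef F n (fun i => z i ω)) (est n ω)) :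
    TendstoInMeasure P (fun (n : ℕ) ω => √(n : ℝ) • (est n ω - a) - (designInfo P F (z 0) a)⁻¹.mulVec
      (scoreSum F a n (fun i => z i ω) (fun i => y i ω))) atTop 0 := by
  obtain ⟨κ, hκ, hκq⟩ := exists_forall_sq_norm_le hpd
  refine tendstoInMeasure_argmin_sub (E := ι → ℝ)
    (D := fun n ω => {s | a + (√(n : ℝ))⁻¹ • s ∈ admissibleCoef F n (fun i => z i ω)})
    (h := fun n ω => localLoss F a n (fun i => z i ω))
    (ℓ := fun n ω => dotProductRight (scoreSum F a n (fun i => z i ω) (fun i => y i ω)))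
    (q := fun s => s ⬝ᵥ (designInfo P F (z 0) a).mulVec s / 2) hκ (by fun_prop)
    (fun n => ae_of_all _ fun ω => convexOn_localLoss a n _) (fun s => ?_)
    h.tendstoInMeasure_localLoss (fun n ω s => ?_) (fun ε hε => h.tight_mulVec_scoreSum _ hε) ?_
  · filter_upwards [h.eventually_ae_forall_mem s] with n hn
    filter_upwards [hn] with ω hω i _ using hω i
  · have := half_quadratic_sub hpd (scoreSum F a n (fun i => z i ω) (fun i => y i ω)) s
    have h2 := hκq (s - (designInfo P F (z 0) a)⁻¹.mulVec
      (scoreSum F a n (fun i => z i ω) (fun i => y i ω)))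
    change _ - _ ⬝ᵥ _ + _ ≤ _ - s ⬝ᵥ _
    rw [this]
    gcongr
  · filter_upwards [eventually_gt_atTop 0] with n hpos
    have hn : √(n : ℝ) ≠ 0 := (Real.sqrt_pos.2 (by exact_mod_cast hpos)).ne'
    filter_upwards [hest n, h.ae_forall_c_pos] with ω hω hc
    have hinv : ∀ a' : ι → ℝ, a + (√(n : ℝ))⁻¹ • (√(n : ℝ) • (a' - a)) = a' := fun a' => by
      rw [smul_smul, inv_mul_cancel₀ hn, one_smul, add_sub_cancel]
    -- For n > 0 the local parametrization is a bijection, and division by -φ turns minima into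
    -- maxima.
    have hiff : ∀ s, IsMinOn (fun s => localLoss F a n (fun i => z i ω) s
          - dotProductRight (scoreSum F a n (fun i => z i ω) (fun i => y i ω)) s)
          {s | a + (√(n : ℝ))⁻¹ • s ∈ admissibleCoef F n (fun i => z i ω)} s ↔
        IsMaxOn (designLogLik F n (fun i => z i ω) (fun i => y i ω))
          (admissibleCoef F n (fun i => z i ω)) (a + (√(n : ℝ))⁻¹ • s) := by
      intro s
      constructor
      · intro hs a' ha'
        have h1 : √(n : ℝ) • (a' - a) ∈
            {s | a + (√(n : ℝ))⁻¹ • s ∈ admissibleCoef F n (fun i => z i ω)} := by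
          rw [Set.mem_ofPred_eq, hinv]
          exact ha'
        have h2 := hs h1
        have h3 := designLogLik_local a (√(n : ℝ) • (a' - a)) n (fun i => z i ω) hc
        rw [hinv] at h3
        simp only [Set.mem_ofPred_eq] at h2 ⊢
        rw [designLogLik_local a s n (fun i => z i ω) hc, h3]
        have := div_le_div_of_nonneg_right h2 F.φ_pos.le
        linarith
      · intro hs s' hs'
        have h2 := hs hs'
        simp only [Set.mem_ofPred_eq] at h2 ⊢
        rw [designLogLik_local a s n (fun i => z i ω) hc,
          designLogLik_local a s' n (fun i => z i ω) hc] at h2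
        exact (div_le_div_iff_of_pos_right F.φ_pos).1 (by linarith)
    rintro ⟨s, hsD, hs⟩
    have h1 := hω ⟨_, hsD, (hiff s).1 hs⟩
    rw [hiff, hinv]
    exact h1

end Estimation

end GVCMM

namespace GVCMM

/-! ## Central limit theorem for the score -/

section CLT

variable {Ω : Type*} [MeasurableSpace Ω] {P : Measure Ω} [IsProbabilityMeasure P]
  {ι : Type*} [Fintype ι] {F : ExpFamily} {a : ι → ℝ} {z : ℕ → Ω → ι → ℝ} {y : ℕ → Ω → ℝ}

/-- The Cramér–Wold device: as `v` is arbitrary, the argument 1 covers the joint characteristic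
function. -/
lemma RegularGLM.tendsto_charFun_dotProduct_scoreSum (h : RegularGLM P F a z y) (v : ι → ℝ) :
    Tendsto (fun n : ℕ => charFun (P.map fun ω =>
      v ⬝ᵥ scoreSum F a n (fun i => z i ω) (fun i => y i ω)) 1) atTop
      (𝓝 (Complex.exp (-(F.φ * (v ⬝ᵥ (designInfo P F (z 0) a).mulVec v) : ℝ) / 2))) := by
  have hm := measurable_score (F := F) a v
  have hvar : Var[fun ω => score F a v (z 0 ω, y 0 ω); P]
      = F.φ * (v ⬝ᵥ (designInfo P F (z 0) a).mulVec v) := by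
    rw [variance_of_integral_eq_zero (h.memLp_score v).aemeasurable (h.integral_score v),
      ← h.integral_score_sq]
  have hclt := tendstoInDistribution_inv_sqrt_mul_sum_sub
    (X := fun i ω => score F a v (z i ω, y i ω)) (P := P)
    (Y := id) (P' := gaussianReal 0 Var[fun ω => score F a v (z 0 ω, y 0 ω); P].toNNReal)
    ⟨aemeasurable_id, Measure.map_id⟩ (h.memLp_score v)
    (h.indep.comp (fun _ => score F a v) fun _ => hm) fun i => (h.ident i).comp hm
  have hlim := ProbabilityMeasure.tendsto_iff_tendsto_charFun.1 hclt.tendsto 1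
  simp only [ProbabilityMeasure.coe_mk, Measure.map_id, h.integral_score, mul_zero, sub_zero,
    charFun_gaussianReal, Complex.ofReal_zero, Complex.ofReal_one] at hlim
  simp only [dotProduct_scoreSum]
  convert! hlim using 3
  rw [Real.coe_toNNReal _ (variance_nonneg _ _), hvar]
  ring

/-- A linear image of the normalized score sum with asymptotic covariance matrix `1` converges in
distribution to the standard Gaussian. -/
lemma RegularGLM.tendstoInDistribution_mulVec_scoreSum (h : RegularGLM P F a z y)
    {κ : Type*} [Fintype κ] [DecidableEq κ] (W : Matrix κ ι ℝ)
    (hW : F.φ • (W * designInfo P F (z 0) a * W.transpose) = 1) :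
    TendstoInDistribution
      (fun (n : ℕ) ω => WithLp.toLp 2
        (W.mulVec (scoreSum F a n (fun i => z i ω) (fun i => y i ω))))
      atTop (id : EuclideanSpace ℝ κ → EuclideanSpace ℝ κ) (fun _ => P)
      (stdGaussian (EuclideanSpace ℝ κ)) where
  forall_aemeasurable n := by
    have := h.measurable_scoreSum n
    have hW : Continuous fun x : ι → ℝ => (WithLp.toLp 2 (W.mulVec x) : EuclideanSpace ℝ κ) := by
      fun_prop
    exact (hW.measurable.comp this).aemeasurable
  aemeasurable_limit := aemeasurable_id
  tendsto := by
    refine ProbabilityMeasure.tendsto_iff_tendsto_charFun.2 fun t => ?_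
    simp only [ProbabilityMeasure.coe_mk, Measure.map_id, charFun_stdGaussian]
    have hlim := h.tendsto_charFun_dotProduct_scoreSum (W.transpose.mulVec t.ofLp)
    -- The hypothesis on `W` makes the limiting variance in direction Wᵀt that of a standard
    -- Gaussian in direction t.
    have hquad : F.φ * ((W.transpose.mulVec t.ofLp) ⬝ᵥ
        (designInfo P F (z 0) a).mulVec (W.transpose.mulVec t.ofLp)) = ‖t‖ ^ 2 := by
      have e := congrArg (fun M : Matrix κ κ ℝ => t.ofLp ⬝ᵥ M.mulVec t.ofLp) hW
      simp only [Matrix.smul_mulVec, dotProduct_smul, smul_eq_mul, Matrix.one_mulVec] at e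
      rw [EuclideanSpace.real_norm_sq_eq, Matrix.mulVec_transpose, ← Matrix.dotProduct_mulVec,
        Matrix.mulVec_mulVec, ← Matrix.mulVec_transpose, Matrix.mulVec_mulVec, e, dotProduct]
      exact Finset.sum_congr rfl fun i _ => (sq _).symm
    rw [hquad] at hlim
    convert! hlim using 2
    · rename_i n
      have hm := h.measurable_scoreSum n
      have hc : Continuous fun x : ι → ℝ => (WithLp.toLp 2 (W.mulVec x) : EuclideanSpace ℝ κ) := by
        fun_prop
      have hd : Continuous fun x : ι → ℝ => (W.transpose.mulVec t.ofLp) ⬝ᵥ x := by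
        unfold dotProduct; fun_prop
      have hm1 : AEMeasurable (fun ω => (WithLp.toLp 2 (W.mulVec (scoreSum F a n
          (fun i => z i ω) fun i => y i ω)) : EuclideanSpace ℝ κ)) P :=
        (hc.measurable.comp hm).aemeasurable
      have hm2 : AEMeasurable (fun ω => W.transpose.mulVec t.ofLp ⬝ᵥ scoreSum F a n
          (fun i => z i ω) fun i => y i ω) P := (hd.measurable.comp hm).aemeasurable
      rw [charFun_apply, charFun_apply, integral_map hm1 (by fun_prop),
        integral_map hm2 (by fun_prop)]
      refine integral_congr_ae (ae_of_all _ fun ω => ?_)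
      have e : ∀ x : ι → ℝ, inner ℝ (WithLp.toLp 2 (W.mulVec x) : EuclideanSpace ℝ κ) t
          = (W.transpose.mulVec t.ofLp) ⬝ᵥ x := by
        intro x
        rw [EuclideanSpace.inner_eq_star_dotProduct, star_trivial, Matrix.mulVec_transpose,
          ← Matrix.dotProduct_mulVec]
      simp only [e]
      simp
    · push_cast
      ring_nf

end CLT

/-! ## Inverse square roots and inverses of block matrices -/

section Matrices

variable {I : Type*} [Fintype I] [DecidableEq I] {A : Matrix I I ℝ}

/-- Every function is continuous on a finite set, so the functional calculus applies to x ↦ (√x)⁻¹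
although it is discontinuous at 0. -/
lemma finite_spectrum_matrix (A : Matrix I I ℝ) : (spectrum ℝ A).Finite := by
  exact Matrix.finite_real_spectrum

lemma invSqrt_smul (hA : A.PosDef) {c : ℝ} (hc : 0 ≤ c) :
    invSqrt (c • A) = (√c)⁻¹ • invSqrt A := by
  have hfin := finite_spectrum_matrix A
  have hsa : IsSelfAdjoint A := hA.isHermitian
  rw [invSqrt, ← cfc_comp_smul c (fun x : ℝ => (√x)⁻¹) A ((hfin.image _).continuousOn _) hsa,
    invSqrt, ← cfc_smul _ _ _ (hfin.continuousOn _)]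
  congr 1
  ext x
  simp [Real.sqrt_mul hc, mul_comm]

lemma invSqrt_transpose (A : Matrix I I ℝ) : (invSqrt A).transpose = invSqrt A := by
  have : IsSelfAdjoint (invSqrt A) := cfc_predicate _ _
  have h := this.star_eq
  rwa [Matrix.star_eq_conjTranspose, Matrix.conjTranspose_eq_transpose_of_trivial] at h

lemma invSqrt_mul_mul_invSqrt (hA : A.PosDef) : invSqrt A * A * invSqrt A = 1 := by
  have hfin := finite_spectrum_matrix A
  have hsa : IsSelfAdjoint A := hA.isHermitian
  have hA' : A = cfc (fun x : ℝ => x) A := (cfc_id' ℝ A hsa).symm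
  have hc : ∀ f : ℝ → ℝ, ContinuousOn f (spectrum ℝ A) := fun f => hfin.continuousOn f
  conv_lhs => rw [invSqrt]; enter [1, 2]; rw [hA']
  rw [← cfc_mul _ _ A (hc _) (hc _), ← cfc_mul _ _ A (hc _) (hc _)]
  rw [← cfc_one ℝ A hsa]
  refine cfc_congr fun x hx => ?_
  have hpos : 0 < x := by
    obtain ⟨i, rfl⟩ := (hA.isHermitian.spectrum_real_eq_range_eigenvalues ▸ hx)
    exact hA.eigenvalues_pos i
  have := Real.sqrt_pos.2 hpos
  have h2 := Real.mul_self_sqrt hpos.le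
  simp only [Pi.one_apply]
  field_simp
  nlinarith

end Matrices

end GVCMM

namespace GVCMM

section BlockInverse

variable {I J : Type*} [Fintype I] [Fintype J] [DecidableEq I] [DecidableEq J]
  {A : Matrix I I ℝ} {B : Matrix I J ℝ} {C : Matrix J I ℝ} {D : Matrix J J ℝ}

lemma isUnit_fromBlocks_of_schur (hA : IsUnit A.det) (hS : IsUnit (D - C * A⁻¹ * B).det) :
    IsUnit (Matrix.fromBlocks A B C D) := by
  have := A.invertibleOfIsUnitDet hA
  rw [Matrix.isUnit_iff_isUnit_det, Matrix.det_fromBlocks₁₁, Matrix.invOf_eq_nonsing_inv]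
  exact hA.mul hS

/-- The lower right block of the inverse of a block matrix is the inverse Schur complement. -/
lemma fromCols_zero_mul_inv_fromBlocks_mul {L : Type*} (hA : IsUnit A.det)
    (hS : IsUnit (D - C * A⁻¹ * B).det) (K : Matrix L J ℝ) :
    Matrix.fromCols (0 : Matrix L I ℝ) K * (Matrix.fromBlocks A B C D)⁻¹
      * (Matrix.fromCols (0 : Matrix L I ℝ) K).transpose
      = K * (D - C * A⁻¹ * B)⁻¹ * K.transpose := by
  have hM := isUnit_fromBlocks_of_schur hA hS
  have iA := A.invertibleOfIsUnitDet hA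
  have iS : Invertible (D - C * ⅟A * B) := by
    rw [Matrix.invOf_eq_nonsing_inv]
    exact Matrix.invertibleOfIsUnitDet _ hS
  have iM := Matrix.invertibleOfIsUnitDet _ ((Matrix.isUnit_iff_isUnit_det _).1 hM)
  rw [← Matrix.invOf_eq_nonsing_inv, Matrix.invOf_fromBlocks₁₁_eq, Matrix.fromCols_mul_fromBlocks,
    Matrix.transpose_fromCols, Matrix.fromCols_mul_fromRows, Matrix.invOf_eq_nonsing_inv (D - _),
    Matrix.invOf_eq_nonsing_inv A]
  simp

end BlockInverse

/-! ## Moments of the score from the conditional law of the response -/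

section Conditional

variable {Ω : Type*} [MeasurableSpace Ω] {P : Measure Ω} [IsProbabilityMeasure P]
  {β : Type*} [MeasurableSpace β] {F : ExpFamily} {X : Ω → β} {Y : Ω → ℝ} {θ : β → ℝ}

lemma ae_c_pos_of_condDistrib (hX : Measurable X) (hY : Measurable Y)
    (hlaw : ∀ᵐ w ∂(P.map X), condDistrib Y X P w = F.law (θ w)) : ∀ᵐ ω ∂P, 0 < F.c (Y ω) := by
  have hm : MeasurableSet {x : β × ℝ | 0 < F.c x.2} :=
    (F.c_measurable.comp measurable_snd) measurableSet_Ioi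
  refine ae_of_ae_map (f := fun ω => (X ω, Y ω)) (p := fun x => 0 < F.c x.2)
    (hX.prodMk hY).aemeasurable ?_
  rw [← compProd_map_condDistrib hY.aemeasurable]
  refine Measure.ae_compProd_of_ae_ae hm ?_
  filter_upwards [hlaw] with w hw
  rw [hw]
  exact ExpFamily.ae_c_pos_law

/-- Given the design, the inner integral is the conditional variance φ b''. Working with Lebesgue
integrals presupposes no integrability, and square integrability of the score is deduced from the
finite information. -/
lemma lintegral_score_sq_of_condDistrib (hX : Measurable X) (hY : Measurable Y)
    (hlaw : ∀ᵐ w ∂(P.map X), condDistrib Y X P w = F.law (θ w)) (hθ : Measurable θ)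
    (hmem : ∀ᵐ w ∂(P.map X), θ w ∈ F.Θ) {g : β → ℝ} (hg : Measurable g) :
    ∫⁻ ω, ENNReal.ofReal (((Y ω - deriv F.b (θ (X ω))) * g (X ω)) ^ 2) ∂P
      = ENNReal.ofReal F.φ
        * ∫⁻ ω, ENNReal.ofReal (g (X ω) ^ 2 * iteratedDeriv 2 F.b (θ (X ω))) ∂P := by
  have hb := measurable_deriv F.b
  have hb2 := ExpFamily.measurable_iteratedDeriv_two_b (F := F)
  have hf : Measurable fun x : β × ℝ =>
      ENNReal.ofReal (((x.2 - deriv F.b (θ x.1)) * g x.1) ^ 2) := by fun_prop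
  have hf2 : Measurable fun w : β =>
      ENNReal.ofReal (g w ^ 2 * iteratedDeriv 2 F.b (θ w)) := by fun_prop
  rw [← lintegral_map hf (hX.prodMk hY), ← compProd_map_condDistrib hY.aemeasurable,
    Measure.lintegral_compProd hf, ← lintegral_map hf2 hX, ← lintegral_const_mul _ hf2]
  refine lintegral_congr_ae ?_
  filter_upwards [hlaw, hmem] with w hw hm
  rw [hw]
  simp_rw [mul_pow, mul_comm _ (g w ^ 2)]
  simp_rw [ENNReal.ofReal_mul (sq_nonneg (g w))]
  rw [lintegral_const_mul _ (by fun_prop), ExpFamily.lintegral_sq_law hm,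
    ENNReal.ofReal_mul F.φ_pos.le]
  ring

/-- The score is centred conditionally on the design, b' being the conditional mean. -/
lemma integral_score_of_condDistrib (hX : Measurable X) (hY : Measurable Y)
    (hlaw : ∀ᵐ w ∂(P.map X), condDistrib Y X P w = F.law (θ w)) (hθ : Measurable θ)
    (hmem : ∀ᵐ w ∂(P.map X), θ w ∈ F.Θ) {g : β → ℝ} (hg : Measurable g)
    (hint : Integrable (fun ω => (Y ω - deriv F.b (θ (X ω))) * g (X ω)) P) :
    ∫ ω, (Y ω - deriv F.b (θ (X ω))) * g (X ω) ∂P = 0 := by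
  have hb := measurable_deriv F.b
  have hf : Measurable fun x : β × ℝ => (x.2 - deriv F.b (θ x.1)) * g x.1 := by fun_prop
  have hint' : Integrable (fun x : β × ℝ => (x.2 - deriv F.b (θ x.1)) * g x.1)
      (P.map fun ω => (X ω, Y ω)) :=
    (integrable_map_measure hf.aestronglyMeasurable (hX.prodMk hY).aemeasurable).2 hint
  rw [← integral_map (f := fun x : β × ℝ => (x.2 - deriv F.b (θ x.1)) * g x.1)
    (hX.prodMk hY).aemeasurable hf.aestronglyMeasurable]
  rw [← compProd_map_condDistrib hY.aemeasurable] at hint' ⊢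
  rw [Measure.integral_compProd hint']
  refine integral_eq_zero_of_ae ?_
  filter_upwards [hlaw, hmem] with w hw hm
  rw [hw]
  simp only [integral_mul_const, ExpFamily.integral_sub_law hm, zero_mul, Pi.zero_apply]

end Conditional

/-! ## The spline regression model as a generalized linear model -/

section Model

variable {Ω : Type*} [MeasurableSpace Ω] {P : Measure Ω} {p q K₀ K₁ : ℕ} {F : ExpFamily}

/-- The pair of coefficient vectors that a single coefficient vector consists of. -/
def splitCoef (v : (Fin p × Fin K₀) ⊕ (Fin q × Fin K₁) → ℝ) : Coef p q K₀ K₁ :=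
  (v ∘ Sum.inl, v ∘ Sum.inr)

/-- The single coefficient vector that a pair of coefficient vectors forms. -/
def joinCoef (a : Coef p q K₀ K₁) : (Fin p × Fin K₀) ⊕ (Fin q × Fin K₁) → ℝ :=
  Sum.elim a.1 a.2

lemma continuous_splitCoef : Continuous (splitCoef (p := p) (q := q) (K₀ := K₀) (K₁ := K₁)) := by
  unfold splitCoef Function.comp
  fun_prop

lemma measurable_joinCoef : Measurable (joinCoef (p := p) (q := q) (K₀ := K₀) (K₁ := K₁)) := by
  refine measurable_pi_lambda _ fun s => ?_
  rcases s with s | s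
  · exact (measurable_pi_apply s).comp measurable_fst
  · exact (measurable_pi_apply s).comp measurable_snd

lemma splitCoef_joinCoef (a : Coef p q K₀ K₁) : splitCoef (joinCoef a) = a := rfl

lemma joinCoef_splitCoef (v : (Fin p × Fin K₀) ⊕ (Fin q × Fin K₁) → ℝ) :
    joinCoef (splitCoef v) = v := by
  ext s
  rcases s with s | s <;> rfl

lemma dotProduct_joinCoef (v : (Fin p × Fin K₀) ⊕ (Fin q × Fin K₁) → ℝ) (w : Coef p q K₀ K₁) :
    v ⬝ᵥ joinCoef w = linPred (splitCoef v) w.1 w.2 := by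
  simp [dotProduct, joinCoef, linPred, splitCoef]

lemma designInfo_joinCoef (ms : Ω → Fin p × Fin K₀ → ℝ) (xs : Ω → Fin q × Fin K₁ → ℝ)
    (v : (Fin p × Fin K₀) ⊕ (Fin q × Fin K₁) → ℝ) :
    designInfo P F (fun ω => joinCoef (ms ω, xs ω)) v = fisherInfo P F ms xs (splitCoef v) := by
  simp only [designInfo, fisherInfo, dotProduct_joinCoef]
  rfl

lemma finiteInfo_joinCoef (ms : Ω → Fin p × Fin K₀ → ℝ) (xs : Ω → Fin q × Fin K₁ → ℝ)
    (v : (Fin p × Fin K₀) ⊕ (Fin q × Fin K₁) → ℝ) :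
    FiniteInfo P F (fun ω => joinCoef (ms ω, xs ω)) v ↔
      (∀ᵐ ω ∂P, linPred (splitCoef v) (ms ω) (xs ω) ∈ F.Θ) ∧
        ∀ s t, Integrable (fun ω => Sum.elim (ms ω) (xs ω) s * Sum.elim (ms ω) (xs ω) t
          * weight F ms xs (splitCoef v) ω) P := by
  simp only [FiniteInfo, dotProduct_joinCoef]
  rfl

lemma fisherInfo_eq_fromBlocks (ms : Ω → Fin p × Fin K₀ → ℝ) (xs : Ω → Fin q × Fin K₁ → ℝ)
    (a : Coef p q K₀ K₁) :
    fisherInfo P F ms xs a = Matrix.fromBlocks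
      (weightedMoment P (weight F ms xs a) ms ms) (weightedMoment P (weight F ms xs a) ms xs)
      (weightedMoment P (weight F ms xs a) xs ms) (weightedMoment P (weight F ms xs a) xs xs) := by
  ext s t
  rcases s with s | s <;> rcases t with t | t <;> rfl

lemma admissibleCoef_joinCoef (n : ℕ) (ms : ℕ → Fin p × Fin K₀ → ℝ) (xs : ℕ → Fin q × Fin K₁ → ℝ)
    (v : (Fin p × Fin K₀) ⊕ (Fin q × Fin K₁) → ℝ) :
    v ∈ admissibleCoef F n (fun i => joinCoef (ms i, xs i)) ↔
      splitCoef v ∈ admissible F n ms xs := by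
  simp only [admissibleCoef, admissible, dotProduct_joinCoef, Set.mem_ofPred_eq]

lemma designLogLik_joinCoef (n : ℕ) (ms : ℕ → Fin p × Fin K₀ → ℝ) (xs : ℕ → Fin q × Fin K₁ → ℝ)
    (y : ℕ → ℝ) (v : (Fin p × Fin K₀) ⊕ (Fin q × Fin K₁) → ℝ) :
    designLogLik F n (fun i => joinCoef (ms i, xs i)) y v = logLik F n ms xs y (splitCoef v) := by
  simp only [designLogLik, logLik, dotProduct_joinCoef]

lemma isMLE_iff_joinCoef (n : ℕ) (ms : ℕ → Fin p × Fin K₀ → ℝ) (xs : ℕ → Fin q × Fin K₁ → ℝ)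
    (y : ℕ → ℝ) (a : Coef p q K₀ K₁) :
    IsMLE F n ms xs y a ↔
      joinCoef a ∈ admissibleCoef F n (fun i => joinCoef (ms i, xs i)) ∧
        IsMaxOn (designLogLik F n (fun i => joinCoef (ms i, xs i)) y)
          (admissibleCoef F n (fun i => joinCoef (ms i, xs i))) (joinCoef a) := by
  rw [IsMLE, admissibleCoef_joinCoef, splitCoef_joinCoef]
  refine and_congr_right fun _ => ⟨fun h v hv => ?_, fun h a' ha' => ?_⟩
  · have := h ((admissibleCoef_joinCoef n ms xs v).1 hv)
    simpa only [Set.mem_ofPred_eq, designLogLik_joinCoef, splitCoef_joinCoef] using this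
  · have := h ((admissibleCoef_joinCoef n ms xs (joinCoef a')).2 (by rwa [splitCoef_joinCoef]))
    simpa only [Set.mem_ofPred_eq, designLogLik_joinCoef, splitCoef_joinCoef] using this

lemma measurable_expand {K : ℕ} {lo hi : ℝ} (β : BSplineBasis lo hi K) {r : ℕ} :
    Measurable fun w : ℝ × (Fin r → ℝ) => expand w.2 (β.eval w.1) := by
  have h := β.measurable_eval
  unfold expand
  fun_prop

/-- Where the spline representation is exact, the true natural parameter is linear in the
coefficients, with no bias term. -/
lemma linPred_expand {lo hi : ℝ} (b₀ : BSplineBasis lo hi K₀) (b₁ : BSplineBasis lo hi K₁)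
    (a : Coef p q K₀ K₁) {t : ℝ} {α₀ : Fin p → ℝ} {α₁ : Fin q → ℝ}
    (h₀ : ∀ j, α₀ j = ∑ k, a.1 (j, k) * b₀.eval t k)
    (h₁ : ∀ l, α₁ l = ∑ k, a.2 (l, k) * b₁.eval t k) (m : Fin p → ℝ) (x : Fin q → ℝ) :
    α₀ ⬝ᵥ m + α₁ ⬝ᵥ x = linPred a (expand m (b₀.eval t)) (expand x (b₁.eval t)) := by
  simp only [linPred, dotProduct, expand, Fintype.sum_prod_type, h₀, h₁, Finset.sum_mul]
  congr 1 <;> refine Finset.sum_congr rfl fun _ _ => Finset.sum_congr rfl fun _ _ => by ring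

end Model

end GVCMM

namespace GVCMM

/-! ### Verification of the model assumptions and standardization of the estimator. -/

section Assembly

variable {Ω : Type*} [MeasurableSpace Ω] {P : Measure Ω} {p q K₀ K₁ : ℕ} {F : ExpFamily}

/-- The response model and the regularity of the likelihood make the spline regression model a
regular generalized linear model. -/
lemma regularGLM_of_model [IsProbabilityMeasure P] {lo hi : ℝ}
    (b₀ : BSplineBasis lo hi K₀) (b₁ : BSplineBasis lo hi K₁)
    {u : ℕ → Ω → ℝ} {m : ℕ → Ω → Fin p → ℝ} {x : ℕ → Ω → Fin q → ℝ} {y : ℕ → Ω → ℝ}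
    (hu : ∀ i, Measurable (u i)) (hm : ∀ i, Measurable (m i)) (hx : ∀ i, Measurable (x i))
    (hy : ∀ i, Measurable (y i))
    (hindep : iIndepFun (fun i ω => (u i ω, m i ω, x i ω, y i ω)) P)
    (hident : ∀ i, IdentDistrib (fun ω => (u i ω, m i ω, x i ω, y i ω))
      (fun ω => (u 0 ω, m 0 ω, x 0 ω, y 0 ω)) P P) (a : Coef p q K₀ K₁)
    (hlaw : ∀ᵐ w ∂(P.map fun ω => (u 0 ω, m 0 ω, x 0 ω)),
      condDistrib (y 0) (fun ω => (u 0 ω, m 0 ω, x 0 ω)) P w = F.law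
        (linPred a (expand w.2.1 (b₀.eval w.1)) (expand w.2.2 (b₁.eval w.1))))
    (hreg : RegularAt P F (fun ω => expand (m 0 ω) (b₀.eval (u 0 ω)))
      (fun ω => expand (x 0 ω) (b₁.eval (u 0 ω))) a) :
    RegularGLM P F (joinCoef a) (fun i ω => joinCoef (expand (m i ω) (b₀.eval (u i ω)),
      expand (x i ω) (b₁.eval (u i ω)))) y := by
  set ζ : ℝ × (Fin p → ℝ) × (Fin q → ℝ) → (Fin p × Fin K₀) ⊕ (Fin q × Fin K₁) → ℝ := fun w =>
    joinCoef (expand w.2.1 (b₀.eval w.1), expand w.2.2 (b₁.eval w.1))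
  have hζ : Measurable ζ := by
    refine measurable_joinCoef.comp (Measurable.prodMk ?_ ?_)
    · exact (measurable_expand b₀ (r := p)).comp
        (measurable_fst.prodMk (measurable_fst.comp measurable_snd))
    · exact (measurable_expand b₁ (r := q)).comp
        (measurable_fst.prodMk (measurable_snd.comp measurable_snd))
  have hdot : ∀ v : (Fin p × Fin K₀) ⊕ (Fin q × Fin K₁) → ℝ, Measurable fun w => v ⬝ᵥ ζ w := by
    intro v
    unfold dotProduct
    fun_prop
  have hX : ∀ i, Measurable fun ω => (u i ω, m i ω, x i ω) := fun i =>
    (hu i).prodMk ((hm i).prodMk (hx i))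
  have hΦ : Measurable fun w : ℝ × (Fin p → ℝ) × (Fin q → ℝ) × ℝ =>
      (ζ (w.1, w.2.1, w.2.2.1), w.2.2.2) := by fun_prop
  have hsplit : Tendsto splitCoef (𝓝 (joinCoef a)) (𝓝 a) :=
    continuous_splitCoef.tendsto (joinCoef a)
  have hfin : ∀ᶠ a' in 𝓝 (joinCoef a), FiniteInfo P F (fun ω => ζ (u 0 ω, m 0 ω, x 0 ω)) a' := by
    filter_upwards [hsplit.eventually hreg.1] with a' ha'
    exact (finiteInfo_joinCoef _ _ a').2 ha'
  have hlaw' : ∀ᵐ w ∂(P.map fun ω => (u 0 ω, m 0 ω, x 0 ω)),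
      condDistrib (y 0) (fun ω => (u 0 ω, m 0 ω, x 0 ω)) P w = F.law (joinCoef a ⬝ᵥ ζ w) := by
    filter_upwards [hlaw] with w hw
    rw [hw]
    congr 1
    have h := dotProduct_joinCoef (joinCoef a)
      (expand w.2.1 (b₀.eval w.1), expand w.2.2 (b₁.eval w.1))
    rw [splitCoef_joinCoef] at h
    exact h.symm
  have hmem : ∀ᵐ w ∂(P.map fun ω => (u 0 ω, m 0 ω, x 0 ω)), joinCoef a ⬝ᵥ ζ w ∈ F.Θ :=
    (ae_map_iff (hX 0).aemeasurable ((hdot _) F.Θ_open.measurableSet)).2 hfin.self_of_nhds.1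
  have hlsq : ∀ v, ∫⁻ ω, ENNReal.ofReal
      (score F (joinCoef a) v (ζ (u 0 ω, m 0 ω, x 0 ω), y 0 ω) ^ 2) ∂P
      = ENNReal.ofReal (F.φ * (v ⬝ᵥ (designInfo P F (fun ω => ζ (u 0 ω, m 0 ω, x 0 ω))
        (joinCoef a)).mulVec v)) := by
    intro v
    rw [ENNReal.ofReal_mul F.φ_pos.le, ← hfin.self_of_nhds.lintegral_sq]
    exact lintegral_score_sq_of_condDistrib (hX 0) (hy 0) hlaw' (hdot _) hmem (hdot v)
  have hms : ∀ v, Measurable fun ω => score F (joinCoef a) v (ζ (u 0 ω, m 0 ω, x 0 ω), y 0 ω) :=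
    fun v => (measurable_score _ v).comp ((hζ.comp (hX 0)).prodMk (hy 0))
  have hL2 : ∀ v, MemLp (fun ω => score F (joinCoef a) v (ζ (u 0 ω, m 0 ω, x 0 ω), y 0 ω)) 2 P := by
    intro v
    refine (memLp_two_iff_integrable_sq (hms v).aestronglyMeasurable).2
      ⟨((hms v).pow_const 2).aestronglyMeasurable, ?_⟩
    rw [hasFiniteIntegral_iff_ofReal (ae_of_all _ fun _ => sq_nonneg _), hlsq v]
    exact ENNReal.ofReal_lt_top
  refine
    { measurable_z := fun i => hζ.comp (hX i)
      measurable_y := hy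
      indep := hindep.comp (fun _ w => (ζ (w.1, w.2.1, w.2.2.1), w.2.2.2)) fun _ => hΦ
      ident := fun i => (hident i).comp hΦ
      finiteInfo := hfin
      continuousAt := ?_
      c_pos := ae_c_pos_of_condDistrib (hX 0) (hy 0) hlaw'
      memLp_score := hL2
      integral_score := fun v => integral_score_of_condDistrib (hX 0) (hy 0) hlaw' (hdot _) hmem
        (hdot v) ((hL2 v).integrable (by norm_num))
      integral_score_sq := fun v => ?_ }
  · have h : ContinuousAt (fun v => fisherInfo P F (fun ω => expand (m 0 ω) (b₀.eval (u 0 ω)))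
        (fun ω => expand (x 0 ω) (b₁.eval (u 0 ω))) (splitCoef v)) (joinCoef a) :=
      ContinuousAt.comp (g := fisherInfo P F (fun ω => expand (m 0 ω) (b₀.eval (u 0 ω)))
        (fun ω => expand (x 0 ω) (b₁.eval (u 0 ω)))) (f := splitCoef)
        (by rw [splitCoef_joinCoef]; exact hreg.2) continuous_splitCoef.continuousAt
    refine h.congr (Eventually.of_forall fun v => ?_)
    exact (designInfo_joinCoef _ _ v).symm
  · rw [integral_eq_lintegral_of_nonneg_ae (ae_of_all _ fun _ => sq_nonneg _)
      ((hms v).pow_const 2).aestronglyMeasurable]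
    refine (congrArg ENNReal.toReal (hlsq v)).trans (ENNReal.toReal_ofReal ?_)
    have := hfin.self_of_nhds.posSemidef.dotProduct_mulVec_nonneg v
    rw [star_trivial] at this
    exact mul_nonneg F.φ_pos.le this

/-- The information is positive semidefinite as a moment matrix, and it is invertible because its
determinant is that of the mediator block times that of the Schur complement. -/
lemma posDef_designInfo {ms : Ω → Fin p × Fin K₀ → ℝ} {xs : Ω → Fin q × Fin K₁ → ℝ}
    {a : Coef p q K₀ K₁} (hreg : RegularAt P F ms xs a)
    (hinv_m : IsUnit (weightedMoment P (weight F ms xs a) ms ms).det)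
    (hinv_x : IsUnit (schurX P (weight F ms xs a) ms xs).det) :
    (designInfo P F (fun ω => joinCoef (ms ω, xs ω)) (joinCoef a)).PosDef := by
  have hfin : FiniteInfo P F (fun ω => joinCoef (ms ω, xs ω)) (joinCoef a) :=
    (finiteInfo_joinCoef _ _ _).2 hreg.1.self_of_nhds
  rw [hfin.posSemidef.posDef_iff_isUnit, designInfo_joinCoef, splitCoef_joinCoef,
    fisherInfo_eq_fromBlocks]
  exact isUnit_fromBlocks_of_schur hinv_m hinv_x

/-- The matrix is a compression of the inverse information by a matrix with injective transpose. -/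
lemma posDef_kronRow_mul_mul {ms : Ω → Fin p × Fin K₀ → ℝ} {xs : Ω → Fin q × Fin K₁ → ℝ}
    {a : Coef p q K₀ K₁}
    (hpd : (designInfo P F (fun ω => joinCoef (ms ω, xs ω)) (joinCoef a)).PosDef)
    (hinv_m : IsUnit (weightedMoment P (weight F ms xs a) ms ms).det)
    (hinv_x : IsUnit (schurX P (weight F ms xs a) ms xs).det) {β : Fin K₁ → ℝ} (hβ : β ≠ 0) :
    (kronRow q β * (schurX P (weight F ms xs a) ms xs)⁻¹ * (kronRow q β).transpose).PosDef := by
  have h := fromCols_zero_mul_inv_fromBlocks_mul hinv_m hinv_x (kronRow q β)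
  rw [← fisherInfo_eq_fromBlocks] at h
  rw [designInfo_joinCoef, splitCoef_joinCoef] at hpd
  rw [schurX, ← h, ← Matrix.conjTranspose_eq_transpose_of_trivial]
  refine hpd.inv.mul_mul_conjTranspose_same ?_
  intro v w hvw
  simp only [Matrix.vecMul_fromCols] at hvw
  refine kronRow_transpose_mulVec_injective hβ ?_
  rw [Matrix.mulVec_transpose, Matrix.mulVec_transpose]
  exact funext fun s => congrFun hvw (Sum.inr s)

/-- A vector statistic with a linear expansion in the score is asymptotically standard Gaussian
after standardization. -/
lemma tendstoInDistribution_of_linear_expansion [IsProbabilityMeasure P] {ι : Type*} [Fintype ι]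
    [DecidableEq ι] {a : ι → ℝ} {z : ℕ → Ω → ι → ℝ} {y : ℕ → Ω → ℝ} (h : RegularGLM P F a z y)
    (hpd : (designInfo P F (z 0) a).PosDef) {κ : Type*} [Fintype κ] [DecidableEq κ]
    {G : Matrix κ κ ℝ} (hG : G.PosDef) (N : Matrix κ ι ℝ)
    (hNG : F.φ • (N * (designInfo P F (z 0) a)⁻¹ * N.transpose) = G) {est : ℕ → Ω → ι → ℝ}
    (hest : TendstoInMeasure P (fun (n : ℕ) ω => √(n : ℝ) • (est n ω - a) -
      (designInfo P F (z 0) a)⁻¹.mulVec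
        (scoreSum F a n (fun i => z i ω) (fun i => y i ω))) atTop 0)
    (hmeas : ∀ n, Measurable (est n)) {T : ℕ → Ω → κ → ℝ}
    (hT : ∀ n ω, 0 < n → T n ω = (invSqrt ((n : ℝ)⁻¹ • G)).mulVec (N.mulVec (est n ω - a)))
    (hT0 : AEMeasurable (T 0) P) :
    TendstoInDistribution (fun n ω => WithLp.toLp 2 (T n ω)) atTop
      (id : EuclideanSpace ℝ κ → EuclideanSpace ℝ κ) (fun _ => P)
      (stdGaussian (EuclideanSpace ℝ κ)) := by
  set J := designInfo P F (z 0) a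
  have hJ : J * J⁻¹ = 1 := Matrix.mul_nonsing_inv _ ((Matrix.isUnit_iff_isUnit_det _).1 hpd.isUnit)
  have hJt : J⁻¹.transpose = J⁻¹ := by
    have := hpd.inv.isHermitian.eq
    rwa [Matrix.conjTranspose_eq_transpose_of_trivial] at this
  have hTn : ∀ n ω, 0 < n →
      T n ω = (invSqrt G * N).mulVec (√(n : ℝ) • (est n ω - a)) := by
    intro n ω hn
    rw [hT n ω hn, invSqrt_smul hG (by positivity), Real.sqrt_inv, inv_inv, Matrix.smul_mulVec,
      Matrix.mulVec_smul, Matrix.mulVec_mulVec]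
  -- The score has covariance φJ, so the limiting covariance is G^(-1/2) (φ N J⁻¹ Nᵀ) G^(-1/2), the
  -- identity.
  have hclt := h.tendstoInDistribution_mulVec_scoreSum (invSqrt G * N * J⁻¹) (by
    rw [Matrix.transpose_mul, Matrix.transpose_mul, hJt, invSqrt_transpose]
    calc F.φ • (invSqrt G * N * J⁻¹ * J * (J⁻¹ * (N.transpose * invSqrt G)))
        = invSqrt G * (F.φ • (N * J⁻¹ * N.transpose)) * invSqrt G := by
          rw [Matrix.mul_assoc (invSqrt G * N * J⁻¹) J, ← Matrix.mul_assoc J, hJ, Matrix.one_mul]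
          simp only [Matrix.mul_smul, Matrix.smul_mul, Matrix.mul_assoc]
      _ = 1 := by rw [hNG, invSqrt_mul_mul_invSqrt hG])
  let L : (ι → ℝ) →L[ℝ] EuclideanSpace ℝ κ := LinearMap.toContinuousLinearMap
    ((WithLp.linearEquiv 2 ℝ (κ → ℝ)).symm.toLinearMap ∘ₗ (invSqrt G * N).mulVecLin)
  have hL : ∀ v, L v = WithLp.toLp 2 ((invSqrt G * N).mulVec v) := fun v => rfl
  -- Slutsky's theorem: a fixed continuous linear image of the expansion error vanishes in
  -- probability.
  refine tendstoInDistribution_of_tendstoInMeasure_sub _ _ hclt ?_ fun n => ?_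
  · have hLm : TendstoInMeasure P (fun (n : ℕ) ω => L (√(n : ℝ) • (est n ω - a) -
        J⁻¹.mulVec (scoreSum F a n (fun i => z i ω) (fun i => y i ω)))) atTop 0 := by
      rw [tendstoInMeasure_iff_norm] at hest ⊢
      intro ε hε
      refine tendsto_of_tendsto_of_tendsto_of_le_of_le tendsto_const_nhds
        (hest (ε / (‖L‖ + 1)) (by positivity)) (fun _ => zero_le) fun n => measure_mono ?_
      intro ω hω
      simp only [Set.mem_ofPred_eq, Pi.zero_apply, sub_zero] at hω ⊢
      rw [div_le_iff₀ (by positivity)]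
      refine hω.trans ((L.le_opNorm _).trans ?_)
      rw [mul_comm]
      gcongr
      linarith
    refine hLm.congr' ?_ EventuallyEq.rfl
    filter_upwards [eventually_gt_atTop 0] with n hn
    refine ae_of_all _ fun ω => ?_
    simp only [Pi.sub_apply]
    rw [map_sub, hL, hL, hTn n ω hn, Matrix.mulVec_mulVec]
  · rcases n.eq_zero_or_pos with rfl | hn
    · exact (WithLp.measurable_toLp 2 (κ → ℝ)).comp_aemeasurable hT0
    · have e : (fun ω => WithLp.toLp 2 (T n ω)) = fun ω => L (√(n : ℝ) • (est n ω - a)) := by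
        ext1 ω
        rw [hTn n ω hn, hL]
      rw [e]
      have := hmeas n
      exact (L.continuous.measurable.comp (by fun_prop)).aemeasurable

end Assembly

end GVCMM

/-! ### Asymptotic normality of the estimated direct effect. -/

theorem theorem1
    {Ω : Type*} [MeasurableSpace Ω] (P : Measure Ω) [IsProbabilityMeasure P]
    {p q K₀ K₁ Kₘ : ℕ} {lo hi : ℝ} (hlohi : lo < hi)
    -- spline bases of fixed degrees and knots, and the exponential family of the response
    (b₀ : BSplineBasis lo hi K₀) (b₁ : BSplineBasis lo hi K₁) (B : BSplineBasis lo hi Kₘ)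
    (F : ExpFamily)
    -- coefficient functions
    (α₀ : ℝ → Fin p → ℝ) (α₁ : ℝ → Fin q → ℝ) (Γ : ℝ → Matrix (Fin q) (Fin p) ℝ)
    -- the random sample and the errors of the mediators
    (u : ℕ → Ω → ℝ) (m : ℕ → Ω → Fin p → ℝ) (x : ℕ → Ω → Fin q → ℝ) (y : ℕ → Ω → ℝ)
    (ε : ℕ → Ω → Fin p → ℝ)
    (hu : ∀ i, Measurable (u i)) (hm : ∀ i, Measurable (m i)) (hx : ∀ i, Measurable (x i))
    (hy : ∀ i, Measurable (y i)) (hε : ∀ i, Measurable (ε i))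
    (hindep : iIndepFun (fun i ω => (u i ω, m i ω, x i ω, y i ω)) P)
    (hident : ∀ i, IdentDistrib (fun ω => (u i ω, m i ω, x i ω, y i ω))
      (fun ω => (u 0 ω, m 0 ω, x 0 ω, y 0 ω)) P P)
    -- the response model with canonical link
    (hresponse : ∀ᵐ w ∂(P.map fun ω => (u 0 ω, m 0 ω, x 0 ω)),
      condDistrib (y 0) (fun ω => (u 0 ω, m 0 ω, x 0 ω)) P w
        = F.law (α₀ w.1 ⬝ᵥ w.2.1 + α₁ w.1 ⬝ᵥ w.2.2))
    -- the mediator model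
    (hmediator : ∀ i, ∀ᵐ ω ∂P, m i ω = Matrix.mulVec (Γ (u i ω)).transpose (x i ω) + ε i ω)
    (hεindep : ∀ i, IndepFun (ε i) (fun ω => (x i ω, u i ω)) P)
    (hεmean : ∀ i j, ∫ ω, ε i ω j ∂P = 0)
    -- condition C1
    (hC1 : ∃ f : ℝ → ℝ, Measurable f ∧
      (∃ c₁ c₂ : ℝ, 0 < c₁ ∧ ∀ t ∈ Set.Icc lo hi, c₁ ≤ f t ∧ f t ≤ c₂) ∧
      ∀ i, P.map (u i)
        = (volume.restrict (Set.Icc lo hi)).withDensity fun t => ENNReal.ofReal (f t))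
    -- condition C2
    (r₁ r₂ : ℕ) (η₁ η₂ L₁ L₂ : ℝ) (hη₁ : η₁ ∈ Set.Ioc (0 : ℝ) 1) (hη₂ : η₂ ∈ Set.Ioc (0 : ℝ) 1)
    (hν₁ : 1 / 2 < (r₁ : ℝ) + η₁) (hν₂ : 1 / 2 < (r₂ : ℝ) + η₂) (hL₁ : 0 < L₁) (hL₂ : 0 < L₂)
    (hC2_α₀ : ∀ j, HolderClass (Set.Icc lo hi) r₁ η₁ L₁ fun t => α₀ t j)
    (hC2_α₁ : ∀ l, HolderClass (Set.Icc lo hi) r₁ η₁ L₁ fun t => α₁ t l)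
    (hC2_Γ : ∀ l j, HolderClass (Set.Icc lo hi) r₂ η₂ L₂ fun t => Γ t l j)
    -- condition C3
    (hxL2 : ∀ l, MemLp (fun ω => x 0 ω l) 2 P) (hmL2 : ∀ j, MemLp (fun ω => m 0 ω j) 2 P)
    (hC3_x : EigenvaluesBounded (secondMoment P (x 0)))
    (hC3_m : EigenvaluesBounded (secondMoment P (m 0)))
    -- condition C4
    (hεL2 : ∀ j, MemLp (fun ω => ε 0 ω j) 2 P)
    (hC4 : EigenvaluesBounded (covMatrix P (ε 0)))
    -- condition C5
    (hC5_Γ : ∀ l j, ContDiffOn ℝ 2 (fun t => Γ t l j) (Set.Icc lo hi))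
    (hC5_α₀ : ∀ j, ContDiffOn ℝ 2 (fun t => α₀ t j) (Set.Icc lo hi))
    (hC5_α₁ : ∀ l, ContDiffOn ℝ 2 (fun t => α₁ t l) (Set.Icc lo hi))
    -- the coefficient functions belong to the spline spaces
    (a : Coef p q K₀ K₁)
    (hspline_α₀ : ∀ t ∈ Set.Icc lo hi, ∀ j, α₀ t j = ∑ k, a.1 (j, k) * b₀.eval t k)
    (hspline_α₁ : ∀ t ∈ Set.Icc lo hi, ∀ l, α₁ t l = ∑ k, a.2 (l, k) * b₁.eval t k)
    (hspline_Γ : ∃ C : Fin q × Fin Kₘ → Fin p → ℝ,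
      ∀ t ∈ Set.Icc lo hi, ∀ l j, Γ t l j = ∑ k, C (l, k) j * B.eval t k)
    -- the spline regressors
    (ms : ℕ → Ω → Fin p × Fin K₀ → ℝ) (hms : ∀ i ω, ms i ω = expand (m i ω) (b₀.eval (u i ω)))
    (xs : ℕ → Ω → Fin q × Fin K₁ → ℝ) (hxs : ∀ i ω, xs i ω = expand (x i ω) (b₁.eval (u i ω)))
    -- regularity at the true coefficients, and invertibility of the matrices that are inverted
    (hreg : RegularAt P F (ms 0) (xs 0) a)
    (hinv_m : IsUnit (weightedMoment P (weight F (ms 0) (xs 0) a) (ms 0) (ms 0)).det)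
    (hinv_x : IsUnit (schurX P (weight F (ms 0) (xs 0) a) (ms 0) (xs 0)).det)
    -- the maximum-likelihood estimator of the spline coefficients
    (est : ℕ → Ω → Coef p q K₀ K₁) (hest : ∀ n, Measurable (est n))
    (hmle : ∀ n, ∀ᵐ ω ∂P,
      (∃ a', IsMLE F n (fun i => ms i ω) (fun i => xs i ω) (fun i => y i ω) a') →
        IsMLE F n (fun i => ms i ω) (fun i => xs i ω) (fun i => y i ω) (est n ω))
    -- the estimated direct effect and its variance
    (α₁hat : ℕ → Ω → ℝ → Fin q → ℝ)
    (hα₁hat : ∀ n ω t, α₁hat n ω t = Matrix.mulVec (kronRow q (b₁.eval t)) (est n ω).2)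
    (V : ℕ → ℝ → Matrix (Fin q) (Fin q) ℝ)
    (hV : ∀ n t, V n t = (F.φ / n) • (kronRow q (b₁.eval t)
      * (schurX P (weight F (ms 0) (xs 0) a) (ms 0) (xs 0))⁻¹
      * (kronRow q (b₁.eval t)).transpose)) :
    ∀ t ∈ Set.Icc lo hi,
      (∀ n, 0 < n → (V n t).PosDef) ∧
      TendstoInDistribution
        (fun n ω => WithLp.toLp 2 (Matrix.mulVec (invSqrt (V n t)) (α₁hat n ω t - α₁ t)))
        atTop (id : EuclideanSpace ℝ (Fin q) → EuclideanSpace ℝ (Fin q)) (fun _ => P)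
        (stdGaussian (EuclideanSpace ℝ (Fin q))) := by
  classical
  -- The spline identities hold only on the interval; the density condition places the index
  -- variable there almost surely.
  have hT : ∀ᵐ ω ∂P, u 0 ω ∈ Set.Icc lo hi := by
    obtain ⟨f, hf, -, hmap⟩ := hC1
    refine ae_of_ae_map (p := fun t => t ∈ Set.Icc lo hi) (hu 0).aemeasurable ?_
    rw [hmap 0]
    exact (withDensity_absolutelyContinuous _ _).ae_le (ae_restrict_mem measurableSet_Icc)
  obtain rfl : ms = fun i ω => expand (m i ω) (b₀.eval (u i ω)) := by
    funext i ω; exact hms i ω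
  obtain rfl : xs = fun i ω => expand (x i ω) (b₁.eval (u i ω)) := by
    funext i ω; exact hxs i ω
  have hlaw : ∀ᵐ w ∂(P.map fun ω => (u 0 ω, m 0 ω, x 0 ω)),
      condDistrib (y 0) (fun ω => (u 0 ω, m 0 ω, x 0 ω)) P w = F.law
        (linPred a (expand w.2.1 (b₀.eval w.1)) (expand w.2.2 (b₁.eval w.1))) := by
    have hT' : ∀ᵐ w ∂(P.map fun ω => (u 0 ω, m 0 ω, x 0 ω)), w.1 ∈ Set.Icc lo hi :=
      (ae_map_iff ((hu 0).prodMk ((hm 0).prodMk (hx 0))).aemeasurable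
        (measurable_fst measurableSet_Icc)).2 hT
    filter_upwards [hresponse, hT'] with w hw hwT
    rw [hw, linPred_expand b₀ b₁ a (hspline_α₀ _ hwT) (hspline_α₁ _ hwT)]
  have hglm := regularGLM_of_model b₀ b₁ hu hm hx hy hindep hident a hlaw hreg
  intro t ht
  have hβ := b₁.eval_ne_zero hlohi ht
  have hpd := posDef_designInfo hreg hinv_m hinv_x
  have hG := posDef_kronRow_mul_mul hpd hinv_m hinv_x hβ
  -- The sample size is separated from a matrix that does not depend on n, so that its inverse
  -- square root contributes exactly √n.
  have hn0 : ∀ n : ℕ, 0 < n → V n t = (n : ℝ)⁻¹ • (F.φ • (kronRow q (b₁.eval t)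
      * (schurX P (weight F (fun ω => expand (m 0 ω) (b₀.eval (u 0 ω)))
        (fun ω => expand (x 0 ω) (b₁.eval (u 0 ω))) a) (fun ω => expand (m 0 ω) (b₀.eval (u 0 ω)))
        (fun ω => expand (x 0 ω) (b₁.eval (u 0 ω))))⁻¹
      * (kronRow q (b₁.eval t)).transpose)) := fun n _ => by
    rw [hV, smul_smul, div_eq_inv_mul]
  have hGφ := hG.smul F.φ_pos
  refine ⟨fun n hn => ?_, ?_⟩
  · rw [hn0 n hn]
    exact hGφ.smul (by positivity)
  have hα : ∀ n ω, α₁hat n ω t - α₁ t = (Matrix.fromCols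
      (0 : Matrix (Fin q) (Fin p × Fin K₀) ℝ) (kronRow q (b₁.eval t))).mulVec
        (joinCoef (est n ω) - joinCoef a) := by
    intro n ω
    have h1 : α₁ t = (kronRow q (b₁.eval t)).mulVec a.2 := by
      ext l
      rw [kronRow_mulVec, hspline_α₁ t ht]
    rw [hα₁hat, h1, Matrix.mulVec_sub, joinCoef, joinCoef, Matrix.fromCols_mulVec_sumElim,
      Matrix.fromCols_mulVec_sumElim, Matrix.zero_mulVec, Matrix.zero_mulVec, zero_add, zero_add]
  set G := F.φ • (kronRow q (b₁.eval t)
      * (schurX P (weight F (fun ω => expand (m 0 ω) (b₀.eval (u 0 ω)))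
        (fun ω => expand (x 0 ω) (b₁.eval (u 0 ω))) a) (fun ω => expand (m 0 ω) (b₀.eval (u 0 ω)))
        (fun ω => expand (x 0 ω) (b₁.eval (u 0 ω))))⁻¹
      * (kronRow q (b₁.eval t)).transpose) with hGdef
  set N := Matrix.fromCols (0 : Matrix (Fin q) (Fin p × Fin K₀) ℝ) (kronRow q (b₁.eval t))
  have hmle' := hglm.tendstoInMeasure_mle hpd (est := fun n ω => joinCoef (est n ω)) fun n => by
    filter_upwards [hmle n] with ω hω
    rintro ⟨a', ha', hmax⟩
    rw [← isMLE_iff_joinCoef]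
    refine hω ⟨splitCoef a', ?_⟩
    rw [isMLE_iff_joinCoef, joinCoef_splitCoef]
    exact ⟨ha', hmax⟩
  have hNG : F.φ • (N * (designInfo P F (fun ω => joinCoef (expand (m 0 ω) (b₀.eval (u 0 ω)),
      expand (x 0 ω) (b₁.eval (u 0 ω)))) (joinCoef a))⁻¹ * N.transpose) = G := by
    rw [hGdef, designInfo_joinCoef, splitCoef_joinCoef, fisherInfo_eq_fromBlocks]
    congr 1
    exact fromCols_zero_mul_inv_fromBlocks_mul hinv_m hinv_x _
  refine tendstoInDistribution_of_linear_expansion hglm hpd hGφ N hNG hmle'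
    (fun n => measurable_joinCoef.comp (hest n))
    (T := fun n ω => (invSqrt (V n t)).mulVec (α₁hat n ω t - α₁ t)) (fun n ω hn => ?_) ?_
  · rw [hα, hn0 n hn]
  -- At n = 0 the factor φ / n is 0 by convention, so only measurability of the statistic is
  -- checked.
  · have hj := measurable_joinCoef.comp (hest 0)
    have hc : Continuous fun v : (Fin p × Fin K₀) ⊕ (Fin q × Fin K₁) → ℝ =>
        (invSqrt (V 0 t)).mulVec (N.mulVec (v - joinCoef a)) := by fun_prop
    simp only [hα]
    exact (hc.measurable.comp hj).aemeasurable
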